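/- Let $\mathbb T\subseteq\mathbb R$ be a time scale (a nonempty closed set), let $\mathbb T^\star=\{s\in\mathbb R:-s\in\mathbb T\}$ be its dual time scale, and for $s_1,s_0\in\mathbb T^\star$ write $[s_1,s_0]_{\mathbb T^\star}=[s_1,s_0]\cap\mathbb T^\star$. Let $n\ge 1$, $\bar A\in\mathbb R^{n\times n}$, $\bar B\in\mathbb R^{n\times m}$, and consider the time-invariant system on $\mathbb T^\star$ $$y^{\hat\nabla}(s)=\bar A\,y(s)+\bar B\,v(s),\qquad s\le s_0,\qquad y(s_0)=y_0 .$$ A control $v:[s_1,s_0]_{\mathbb T^\star}\to\mathbb R^m$ is piecewise ld-continuous if it has finite one-sided limits at the left-dense points (from the left) and at the right-dense points (from the right) of $[s_1,s_0]_{\mathbb T^\star}$ and is continuous at all but finitely many of the left-dense points. The corresponding backward solution is the continuous function $y:[s_1,s_0]_{\mathbb T^\star}\to\mathbb R^n$ with $y(s_0)=y_0$ that satisfies the equation, with the nabla derivative taken on the time scale $[s_1,s_0]_{\mathbb T^\star}$, at every $s\in[s_1,s_0]_{\mathbb T^\star}$ with $s>s_1$, except at the left-dense points where $v$ is discontinuous.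 The reachable set $\bar{\mathcal R}_{y_0}(s_1,s_0)$ is the set of the values $y(s_1)$ for all such controls $v$. The system is controllable if for any $y_0,y_1\in\mathbb R^n$ there exist $s_0,s_1\in\mathbb T^\star$ with $s_1<s_0$ such that $y_1\in\bar{\mathcal R}_{y_0}(s_1,s_0)$. Let $\lambda_1,\dots,\lambda_n\in\mathbb C$ be the eigenvalues of $\bar A$, listed with algebraic multiplicity in any order, and let $\bar P_0=I$, $\bar P_{k+1}=(\bar A-\lambda_{k+1}I)\bar P_k$. Let $y_0\in\mathbb R^n$ and let $s_1,s_0\in\mathbb T^\star$ be such that $[s_1,s_0]_{\mathbb T^\star}$ has at least $n+1$ elements. Then the following conditions are equivalent: (i) $\bar{\mathcal R}_{y_0}(s_1,s_0)=\mathbb R^n$; (ii) $\operatorname{rank}(\bar P_0\bar B,\bar P_1\bar B,\dots,\bar P_{n-1}\bar B)=n$ (rank over $\mathbb C$); (iii) $\operatorname{rank}(\bar B,\bar A\bar B,\dots,\bar A^{n-1}\bar B)=n$; (iv) the system is controllable. -/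

import Mathlib

open Set Filter Topology

namespace NablaControl

noncomputable section

/-- A time scale: a nonempty closed subset of the real line. -/
def IsTimeScale (T : Set ℝ) : Prop := T.Nonempty ∧ IsClosed T

/-- The dual time scale `T* = {s : -s ∈ T}`. -/
def dual (T : Set ℝ) : Set ℝ := {s | -s ∈ T}

/-- The time scale interval `[a, b]_T = [a, b] ∩ T`. -/
def interval (T : Set ℝ) (a b : ℝ) : Set ℝ := Icc a b ∩ T

open Classical in
/-- The backward jump operator `ρ(s) = sup {τ ∈ T : τ < s}`, with `ρ(s) = s` when there is no
point of `T` to the left of `s`. -/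
def backwardJump (T : Set ℝ) (s : ℝ) : ℝ :=
  if (T ∩ Iio s).Nonempty then sSup (T ∩ Iio s) else s

open Classical in
/-- The forward jump operator `σ(s) = inf {τ ∈ T : s < τ}`, with `σ(s) = s` when there is no
point of `T` to the right of `s`. -/
def forwardJump (T : Set ℝ) (s : ℝ) : ℝ :=
  if (T ∩ Ioi s).Nonempty then sInf (T ∩ Ioi s) else s

/-- `s` is a left-dense point of `T`: it is not the minimum of `T` and `ρ(s) = s`. -/
def IsLeftDense (T : Set ℝ) (s : ℝ) : Prop :=
  s ∈ T ∧ (∃ τ ∈ T, τ < s) ∧ backwardJump T s = s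

/-- `s` is a right-dense point of `T`: it is not the maximum of `T` and `σ(s) = s`. -/
def IsRightDense (T : Set ℝ) (s : ℝ) : Prop :=
  s ∈ T ∧ (∃ τ ∈ T, s < τ) ∧ forwardJump T s = s

/-- `d` is the nabla derivative of `f` on the time scale `T` at `s` (meaningful at points `s` of
`T` that are not a right-scattered minimum): for every `ε > 0` there is a neighbourhood of `s` such
that `‖f (ρ s) - f τ - (ρ s - τ) d‖ ≤ ε |ρ s - τ|` for all `τ ∈ T` in it. -/
def HasNablaDerivAt {n : ℕ} (T : Set ℝ) (f : ℝ → Fin n → ℝ) (d : Fin n → ℝ) (s : ℝ) : Prop :=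
  ∀ ε > 0, ∃ δ > 0, ∀ τ ∈ T, |τ - s| < δ →
    ‖f (backwardJump T s) - f τ - (backwardJump T s - τ) • d‖ ≤ ε * |backwardJump T s - τ|

/-- A regulated function on `T`: finite right-sided limits exist at all right-dense points and
finite left-sided limits exist at all left-dense points. -/
def IsRegulated {m : ℕ} (T : Set ℝ) (f : ℝ → Fin m → ℝ) : Prop :=
  (∀ s, IsRightDense T s → ∃ l, Tendsto f (𝓝[T ∩ Ioi s] s) (𝓝 l)) ∧
  (∀ s, IsLeftDense T s → ∃ l, Tendsto f (𝓝[T ∩ Iio s] s) (𝓝 l))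

/-- A piecewise ld-continuous function on `T`: it is regulated, and it is continuous (along `T`) at
all left-dense points of `T` with at most finitely many exceptions. (With no exceptions this is
ld-continuity.) -/
def IsPiecewiseLdContinuous {m : ℕ} (T : Set ℝ) (f : ℝ → Fin m → ℝ) : Prop :=
  IsRegulated T f ∧ {s | IsLeftDense T s ∧ ¬ ContinuousWithinAt f T s}.Finite

/-- `y` is the backward solution on `[s₁, s₀]_T` of `y^∇ = A y + B v`, `y s₀ = y₀`: it is
continuous on `[s₁, s₀]_T` and satisfies the equation at every `s ∈ (s₁, s₀]_T`, except at those
left-dense points where the control `v` is discontinuous. All notions are taken on the time scale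
`[s₁, s₀]_T`, on whose points `s > s₁` the backward jump is the same as on `T`. -/
def IsBackwardSolution {n m : ℕ} (T : Set ℝ) (A : Matrix (Fin n) (Fin n) ℝ)
    (B : Matrix (Fin n) (Fin m) ℝ) (y₀ : Fin n → ℝ) (s₁ s₀ : ℝ)
    (v : ℝ → Fin m → ℝ) (y : ℝ → Fin n → ℝ) : Prop :=
  y s₀ = y₀ ∧ ContinuousOn y (interval T s₁ s₀) ∧
  ∀ s ∈ interval T s₁ s₀, s₁ < s →
    (IsLeftDense (interval T s₁ s₀) s → ContinuousWithinAt v (interval T s₁ s₀) s) →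
    HasNablaDerivAt (interval T s₁ s₀) y (A.mulVec (y s) + B.mulVec (v s)) s

/-- The set of all points reachable from `y₀ = y s₀` in time `s₁` by means of piecewise
ld-continuous controls on `[s₁, s₀]_T`. -/
def reachableSet {n m : ℕ} (T : Set ℝ) (A : Matrix (Fin n) (Fin n) ℝ)
    (B : Matrix (Fin n) (Fin m) ℝ) (y₀ : Fin n → ℝ) (s₁ s₀ : ℝ) : Set (Fin n → ℝ) :=
  {y₁ | ∃ (v : ℝ → Fin m → ℝ) (y : ℝ → Fin n → ℝ),
    IsPiecewiseLdContinuous (interval T s₁ s₀) v ∧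
    IsBackwardSolution T A B y₀ s₁ s₀ v y ∧ y s₁ = y₁}

/-- The system `y^∇ = A y + B v` on `T` is controllable: for any two states `y₀`, `y₁` there are
`s₁ < s₀` in `T` and a piecewise ld-continuous control on `[s₁, s₀]_T` steering `y s₀ = y₀` to
`y s₁ = y₁`. -/
def IsControllable {n m : ℕ} (T : Set ℝ) (A : Matrix (Fin n) (Fin n) ℝ)
    (B : Matrix (Fin n) (Fin m) ℝ) : Prop :=
  ∀ y₀ y₁ : Fin n → ℝ, ∃ s₀ ∈ T, ∃ s₁ ∈ T, s₁ < s₀ ∧ y₁ ∈ reachableSet T A B y₀ s₁ s₀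

/-- The matrices `P₀ = I`, `P_{k+1} = (A - λ_{k+1} I) P_k`. The eigenvalues of a real matrix are
complex numbers in general, so these are complex matrices. -/
def P {n : ℕ} (A : Matrix (Fin n) (Fin n) ℝ) (lam : ℕ → ℂ) : ℕ → Matrix (Fin n) (Fin n) ℂ
  | 0 => 1
  | k + 1 => (A.map Complex.ofReal - lam (k + 1) • (1 : Matrix (Fin n) (Fin n) ℂ)) * P A lam k

/-- The `n × (n m)` block matrix `(M₀, M₁, …, M_{n-1})` formed by `n × m` blocks. -/
def blockRow {R : Type*} {n m : ℕ} (M : ℕ → Matrix (Fin n) (Fin m) R) :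
    Matrix (Fin n) (Fin n × Fin m) R :=
  Matrix.of fun i kj => M kj.1 i kj.2

end

end NablaControl

namespace NablaControl

/-! Both rank conditions say that no nonzero row vector `w` annihilates all the blocks. Since `P A
lam k` is a monic polynomial of degree `k` in `A`, the two families of blocks have the same
annihilators; passing between ℝ and ℂ only splits `w` into real and imaginary parts.

Necessity: if `w` annihilates every `A ^ k * B` with `k < n`, it does so for all `k` by
Cayley–Hamilton, so the common kernel `V` of the functionals `w A ^ k` is `A`-invariant and contains
the range of `B`. Modulo `V` the control disappears, and Grönwall uniqueness
(`eq_zero_of_nablaDeriv_le`) puts the difference of two states reached from one initial state into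
`V`. If every vector is such a difference, then `w ∈ V`, so `w ⬝ᵥ w = 0`.

Sufficiency: step controls are enough. The control equal to `u` up to `b` and to `0` beyond has
response `psi S X b t (B u)`, where `psi` is an explicit power series in `X = A`, so no existence
theorem is required. Let `W_b` be the span of the responses at `s₁` of steps at points up to `b`.
Differences of steps at `a < c ≤ b`, divided by `c - a`, tend to or equal the transition operator
from `a` to `s₁` applied to `B u`, up to sign; hence `B u + X (psi S X a s₁ (B u)) ∈ W_b`.
Consequently `W_b` contains `B u` and `X` maps `W_a` into `W_b` for `a < b`. Each further point of
the time scale gains one power of `X`, so `n + 1` points yield all `A ^ j B u` with `j < n`. -/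

/-! ### Backward jumps and induction on closed sets. -/

lemma backwardJump_of_exists {S : Set ℝ} {s : ℝ} (h : ∃ τ ∈ S, τ < s) :
    backwardJump S s = sSup (S ∩ Iio s) := by
  obtain ⟨τ, hτ, hlt⟩ := h
  exact if_pos ⟨τ, hτ, hlt⟩

lemma backwardJump_le {S : Set ℝ} {s : ℝ} (h : ∃ τ ∈ S, τ < s) : backwardJump S s ≤ s := by
  rw [backwardJump_of_exists h]
  obtain ⟨τ, hτ, hlt⟩ := h
  exact csSup_le ⟨τ, hτ, hlt⟩ fun x hx => hx.2.le

lemma le_backwardJump {S : Set ℝ} {s τ : ℝ} (hτ : τ ∈ S) (h : τ < s) : τ ≤ backwardJump S s := by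
  rw [backwardJump_of_exists ⟨τ, hτ, h⟩]
  exact le_csSup ⟨s, fun x hx => hx.2.le⟩ ⟨hτ, h⟩

lemma backwardJump_mem {S : Set ℝ} (hS : IsClosed S) {s : ℝ} (h : ∃ τ ∈ S, τ < s) :
    backwardJump S s ∈ S := by
  rw [backwardJump_of_exists h]
  obtain ⟨τ, hτ, hlt⟩ := h
  exact closure_minimal inter_subset_left hS
    (csSup_mem_closure (s := S ∩ Iio s) ⟨τ, hτ, hlt⟩ ⟨s, fun x hx => hx.2.le⟩)

/-- An induction principle running downwards through a closed set of reals. -/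
theorem downward_induction {S : Set ℝ} (hS : IsClosed S) {a b : ℝ} (hsub : S ⊆ Icc a b)
    (hb : b ∈ S) {p : ℝ → Prop} (h0 : p b)
    (hscat : ∀ s ∈ S, (∃ τ ∈ S, τ < s) → backwardJump S s < s → p s → p (backwardJump S s))
    (hdense : ∀ s, IsLeftDense S s → p s → ∃ δ > 0, ∀ r ∈ S, s - δ < r → r < s → p r)
    (hlim : ∀ s ∈ S, s ∈ closure (S ∩ Ioi s) → (∀ r ∈ S, s < r → p r) → p s) :
    ∀ s ∈ S, p s := by
  set G : Set ℝ := {t | t ∈ S ∧ ∀ r ∈ S, t ≤ r → p r} with hG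
  have hbG : b ∈ G := ⟨hb, fun r hr hbr => by rwa [le_antisymm (hsub hr).2 hbr]⟩
  have hbdd : BddBelow G := ⟨a, fun x hx => (hsub hx.1).1⟩
  set c := sInf G with hc
  have hcS : c ∈ S := closure_minimal (fun x hx => hx.1) hS (csInf_mem_closure ⟨b, hbG⟩ hbdd)
  have habove : ∀ r ∈ S, c < r → p r := by
    intro r hr hcr
    obtain ⟨t, ht, htr⟩ := exists_lt_of_csInf_lt (s := G) ⟨b, hbG⟩ hcr
    exact ht.2 r hr htr.le
  have hcp : p c := by
    by_cases hcG : c ∈ G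
    · exact hcG.2 c hcS le_rfl
    · refine hlim c hcS ?_ habove
      refine closure_mono ?_ (csInf_mem_closure ⟨b, hbG⟩ hbdd)
      intro x hx
      refine ⟨hx.1, lt_of_le_of_ne (csInf_le hbdd hx) ?_⟩
      rintro rfl
      exact hcG hx
  -- Unless `c` is the minimum of `S`, the scattered or the dense step produces an element of `G`
  -- below `c = sInf G`.
  by_cases hex : ∃ τ ∈ S, τ < c
  · exfalso
    rcases (backwardJump_le hex).lt_or_eq with hlt | heq
    · have hmem : backwardJump S c ∈ G := by
        refine ⟨backwardJump_mem hS hex, fun r hr hle => ?_⟩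
        rcases lt_trichotomy r c with h | h | h
        · rw [le_antisymm (le_backwardJump hr h) hle]
          exact hscat c hcS hex hlt hcp
        · rwa [h]
        · exact habove r hr h
      exact absurd (csInf_le hbdd hmem) (not_le.2 hlt)
    · obtain ⟨δ, hδ, h⟩ := hdense c ⟨hcS, hex, heq⟩ hcp
      have : c - δ < sSup (S ∩ Iio c) := by
        rw [← backwardJump_of_exists hex, heq]; linarith
      obtain ⟨τ, hτ, hτc⟩ := hex
      obtain ⟨x, hx, hcx⟩ := exists_lt_of_lt_csSup (s := S ∩ Iio c) ⟨τ, hτ, hτc⟩ this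
      have hmem : x ∈ G := by
        refine ⟨hx.1, fun r hr hle => ?_⟩
        rcases lt_trichotomy r c with h' | h' | h'
        · exact h r hr (hcx.trans_le hle) h'
        · rwa [h']
        · exact habove r hr h'
      exact absurd (csInf_le hbdd hmem) (not_le.2 hx.2)
  · push Not at hex
    intro s hs
    rcases (hex s hs).lt_or_eq with h | h
    · exact habove s hs h
    · rwa [← h]

/-! ### Nabla derivatives and Grönwall uniqueness. -/

/-- The definition tested at `τ = s`, which lies in every neighbourhood, bounds a fixed error by
arbitrarily small multiples of the jump. -/
lemma HasNablaDerivAt.jump_eq {n : ℕ} {S : Set ℝ} {f : ℝ → Fin n → ℝ} {d : Fin n → ℝ} {s : ℝ}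
    (h : HasNablaDerivAt S f d s) (hs : s ∈ S) :
    f (backwardJump S s) = f s + (backwardJump S s - s) • d := by
  have key : ‖f (backwardJump S s) - f s - (backwardJump S s - s) • d‖ ≤ 0 := by
    refine le_of_forall_pos_le_add fun ε hε => ?_
    have hpos : 0 < |backwardJump S s - s| + 1 := by positivity
    obtain ⟨δ, hδ, hh⟩ := h (ε / (|backwardJump S s - s| + 1)) (by positivity)
    refine (hh s hs (by simpa using hδ)).trans ?_
    rw [zero_add, div_mul_eq_mul_div, div_le_iff₀ hpos]
    nlinarith
  have := norm_le_zero_iff.1 key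
  rw [sub_sub, sub_eq_zero] at this
  exact this

lemma HasNablaDerivAt.add {n : ℕ} {S : Set ℝ} {f g : ℝ → Fin n → ℝ} {d e : Fin n → ℝ} {s : ℝ}
    (hf : HasNablaDerivAt S f d s) (hg : HasNablaDerivAt S g e s) :
    HasNablaDerivAt S (fun t => f t + g t) (d + e) s := by
  intro ε hε
  obtain ⟨δ, hδ, h⟩ := hf (ε / 2) (by positivity)
  obtain ⟨δ', hδ', h'⟩ := hg (ε / 2) (by positivity)
  refine ⟨min δ δ', lt_min hδ hδ', fun τ hτ hlt => ?_⟩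
  have h1 := h τ hτ (hlt.trans_le (min_le_left _ _))
  have h2 := h' τ hτ (hlt.trans_le (min_le_right _ _))
  calc _ = ‖(f (backwardJump S s) - f τ - (backwardJump S s - τ) • d)
        + (g (backwardJump S s) - g τ - (backwardJump S s - τ) • e)‖ := by
        congr 1; module
    _ ≤ _ := (norm_add_le _ _).trans (by linarith)

lemma HasNablaDerivAt.clm_comp {n : ℕ} {S : Set ℝ} {f : ℝ → Fin n → ℝ} {d : Fin n → ℝ} {s : ℝ}
    (hf : HasNablaDerivAt S f d s) (M : (Fin n → ℝ) →L[ℝ] (Fin n → ℝ)) :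
    HasNablaDerivAt S (fun t => M (f t)) (M d) s := by
  intro ε hε
  have hpos : 0 < ‖M‖ + 1 := by positivity
  obtain ⟨δ, hδ, h⟩ := hf (ε / (‖M‖ + 1)) (by positivity)
  refine ⟨δ, hδ, fun τ hτ hlt => ?_⟩
  rw [← map_smul, ← map_sub, ← map_sub]
  refine (M.le_opNorm _).trans ?_
  have h1 := h τ hτ hlt
  calc _ ≤ (‖M‖ + 1) * (ε / (‖M‖ + 1) * |backwardJump S s - τ|) := by
        gcongr; linarith
    _ = _ := by field_simp

lemma HasNablaDerivAt.sub {n : ℕ} {S : Set ℝ} {f g : ℝ → Fin n → ℝ} {d e : Fin n → ℝ} {s : ℝ}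
    (hf : HasNablaDerivAt S f d s) (hg : HasNablaDerivAt S g e s) :
    HasNablaDerivAt S (fun t => f t - g t) (d - e) s := by
  have := hf.add (hg.clm_comp (-ContinuousLinearMap.id ℝ (Fin n → ℝ)))
  simpa [sub_eq_add_neg] using this

lemma hasNablaDerivAt_const {n : ℕ} {S : Set ℝ} {s : ℝ} (x : Fin n → ℝ) :
    HasNablaDerivAt S (fun _ => x) 0 s := by
  intro ε hε
  refine ⟨1, one_pos, fun τ _ _ => ?_⟩
  simp only [sub_self, smul_zero, norm_zero]
  positivity

lemma HasNablaDerivAt.sum {n : ℕ} {ι : Type*} {S : Set ℝ} {f : ι → ℝ → Fin n → ℝ}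
    {d : ι → Fin n → ℝ} {s : ℝ} {F : Finset ι} (h : ∀ i ∈ F, HasNablaDerivAt S (f i) (d i) s) :
    HasNablaDerivAt S (fun t => ∑ i ∈ F, f i t) (∑ i ∈ F, d i) s := by
  classical
  induction F using Finset.induction_on with
  | empty => simpa using hasNablaDerivAt_const 0
  | insert i F hi ih =>
    simp only [Finset.sum_insert hi]
    exact (h i (Finset.mem_insert_self i F)).add
      (ih fun j hj => h j (Finset.mem_insert_of_mem hj))

/-- Grönwall uniqueness: a continuous function vanishing at the right end whose nabla derivative is
dominated by the function, off finitely many left-dense points, is zero. -/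
theorem eq_zero_of_nablaDeriv_le {n : ℕ} {S : Set ℝ} (hS : IsClosed S) {a b : ℝ}
    (hsub : S ⊆ Icc a b) (hb : b ∈ S) {z d : ℝ → Fin n → ℝ} (hz : ContinuousOn z S)
    (hz0 : z b = 0) {F : Set ℝ} (hF : F.Finite) {L : ℝ} (hL : 0 ≤ L)
    (hd : ∀ s ∈ S, (∃ τ ∈ S, τ < s) → (IsLeftDense S s → s ∉ F) → HasNablaDerivAt S z (d s) s)
    (hdL : ∀ s ∈ S, ‖d s‖ ≤ L * ‖z s‖) : ∀ s ∈ S, z s = 0 := by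
  -- Counts the exceptional points already passed on the way down from `b`; each is allowed to cost
  -- one extra `ε` in the bound `ε * (1 + N) * φ`.
  set N : ℝ → ℝ := fun t => ((F ∩ Ioi t).ncard : ℝ) with hN
  have hNanti : Antitone N := fun x y hxy => by
    simp only [hN, Nat.cast_le]
    exact ncard_le_ncard (inter_subset_inter_right _ (Ioi_subset_Ioi hxy)) (hF.inter_of_left _)
  have hN0 : ∀ t, 0 ≤ N t := fun t => by simp [hN]
  have hNstep : ∀ s ∈ F, ∀ r < s, N s + 1 ≤ N r := by
    intro s hs r hr
    simp only [hN]
    have : F ∩ Ioi s ⊂ F ∩ Ioi r := by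
      refine ⟨inter_subset_inter_right _ (Ioi_subset_Ioi hr.le), fun h => ?_⟩
      exact lt_irrefl s (h ⟨hs, hr⟩).2
    exact_mod_cast ncard_lt_ncard this (hF.inter_of_left _)
  -- Rate `L` pays for the derivative, the extra `1` for the error `ε * (s - r)` in the definition
  -- of the nabla derivative.
  set φ : ℝ → ℝ := fun t => Real.exp ((L + 1) * (b - t)) with hφ
  have hφ1 : ∀ t ≤ b, 1 ≤ φ t := fun t ht =>
    Real.one_le_exp (mul_nonneg (by linarith) (by linarith))
  have hφstep : ∀ s r, φ s * (1 + (L + 1) * (s - r)) ≤ φ r := by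
    intro s r
    have : φ r = φ s * Real.exp ((L + 1) * (s - r)) := by
      simp only [hφ]; rw [← Real.exp_add]; congr 1; ring
    rw [this]
    gcongr
    linarith [Real.add_one_le_exp ((L + 1) * (s - r))]
  have key : ∀ ε > 0, ∀ s ∈ S, ‖z s‖ ≤ ε * (1 + N s) * φ s := by
    intro ε hε
    have hφ0 : ∀ t, 0 < φ t := fun t => Real.exp_pos _
    refine downward_induction hS hsub hb ?_ ?_ ?_ ?_
    · rw [hz0, norm_zero]
      have := hN0 b; have := hφ0 b
      positivity
    · intro s hs hex hlt hp
      have hder := (hd s hs hex fun h => absurd h.2.2 hlt.ne).jump_eq hs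
      rw [hder]
      set r := backwardJump S s
      have h1 : ‖z s + (r - s) • d s‖ ≤ ‖z s‖ * (1 + (L + 1) * (s - r)) := by
        refine (norm_add_le _ _).trans ?_
        rw [norm_smul, Real.norm_eq_abs, abs_sub_comm, abs_of_pos (sub_pos.2 hlt)]
        have := mul_le_mul_of_nonneg_left (hdL s hs) (sub_pos.2 hlt).le
        nlinarith [norm_nonneg (z s), mul_nonneg (norm_nonneg (z s)) (sub_pos.2 hlt).le]
      have h2 : 0 ≤ 1 + (L + 1) * (s - r) := by
        have := mul_nonneg (by linarith : (0:ℝ) ≤ L + 1) (sub_pos.2 hlt).le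
        linarith
      have h3 : 0 ≤ 1 + N s := by linarith [hN0 s]
      calc _ ≤ ε * (1 + N s) * φ s * (1 + (L + 1) * (s - r)) :=
            h1.trans (mul_le_mul_of_nonneg_right hp h2)
        _ = ε * (1 + N s) * (φ s * (1 + (L + 1) * (s - r))) := by ring
        _ ≤ ε * (1 + N s) * φ r := mul_le_mul_of_nonneg_left (hφstep s r) (by positivity)
        _ ≤ _ := by
          have := hNanti hlt.le
          have := hφ0 r
          gcongr
    · intro s hs hp
      -- At an exceptional point only continuity is available: the norm grows by at most `ε`, and
      -- `N` increases by at least one just below `s`.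
      by_cases hsF : s ∈ F
      · obtain ⟨δ, hδ, h⟩ := Metric.continuousWithinAt_iff.1 (hz s hs.1) ε hε
        refine ⟨δ, hδ, fun r hr hr1 hr2 => ?_⟩
        have h1 := h hr (by rw [Real.dist_eq, abs_lt]; constructor <;> linarith)
        rw [dist_eq_norm] at h1
        have h2 : ‖z r‖ ≤ ‖z s‖ + ε := by
          have := norm_add_le (z r - z s) (z s)
          rw [sub_add_cancel] at this
          linarith
        have h3 := hNstep s hsF r hr2
        have h4 : φ s ≤ φ r := by
          simp only [hφ]
          gcongr
        have h5 := hφ1 r (hsub hr).2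
        have h6 := hN0 s
        calc ‖z r‖ ≤ ε * (1 + N s) * φ s + ε := by linarith
          _ ≤ ε * (1 + N s) * φ r + ε * φ r := by
            gcongr
            nlinarith
          _ = ε * (1 + (N s + 1)) * φ r := by ring
          _ ≤ _ := by
            have := hφ0 r
            gcongr
      · obtain ⟨δ, hδ, h⟩ := hd s hs.1 hs.2.1 (fun _ => hsF) ε hε
        refine ⟨δ, hδ, fun r hr hr1 hr2 => ?_⟩
        have h1 := h r hr (by rw [abs_lt]; constructor <;> linarith)
        rw [hs.2.2, abs_of_pos (sub_pos.2 hr2)] at h1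
        have hsr := sub_pos.2 hr2
        have h2 : ‖z r‖ ≤ ‖z s‖ + (s - r) * ‖d s‖ + ε * (s - r) := by
          have e : z r = z s - (s - r) • d s - (z s - z r - (s - r) • d s) := by abel
          calc ‖z r‖ = ‖z s - (s - r) • d s - (z s - z r - (s - r) • d s)‖ := by rw [← e]
            _ ≤ ‖z s‖ + ‖(s - r) • d s‖ + ‖z s - z r - (s - r) • d s‖ :=
              (norm_sub_le _ _).trans (by gcongr; exact norm_sub_le _ _)
            _ ≤ _ := by
              rw [norm_smul, Real.norm_eq_abs, abs_of_pos hsr]; linarith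
        have h3 := mul_le_mul_of_nonneg_left (hdL s hs.1) hsr.le
        have h4 := hφ1 s (hsub hs.1).2
        have h6 := hN0 s
        set X := ε * (1 + N s) * φ s with hX
        have hXε : ε ≤ X := by
          rw [hX]
          have : 1 ≤ (1 + N s) * φ s := by nlinarith
          nlinarith
        calc ‖z r‖ ≤ X * (1 + (L + 1) * (s - r)) := by
              have := mul_le_mul_of_nonneg_right hXε hsr.le
              have := mul_le_mul_of_nonneg_left hp (mul_nonneg hsr.le hL)
              nlinarith
          _ = ε * (1 + N s) * (φ s * (1 + (L + 1) * (s - r))) := by rw [hX]; ring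
          _ ≤ ε * (1 + N s) * φ r := mul_le_mul_of_nonneg_left (hφstep s r) (by positivity)
          _ ≤ _ := by
            have := hNanti hr2.le
            have := hφ0 r
            gcongr
    · intro s hs hcl hp
      have hne : (𝓝[S ∩ Ioi s] s).NeBot := mem_closure_iff_nhdsWithin_neBot.1 hcl
      have hcont : Tendsto (fun r => ‖z r‖) (𝓝[S ∩ Ioi s] s) (𝓝 ‖z s‖) :=
        ((hz s hs).mono inter_subset_left).norm
      have hcont' : Tendsto (fun r => ε * (1 + N s) * φ r) (𝓝[S ∩ Ioi s] s)
          (𝓝 (ε * (1 + N s) * φ s)) := by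
        have : Continuous fun r => ε * (1 + N s) * φ r := by simp only [hφ]; fun_prop
        exact this.continuousAt.mono_left nhdsWithin_le_nhds
      refine le_of_tendsto_of_tendsto hcont hcont' ?_
      filter_upwards [self_mem_nhdsWithin] with r hr
      refine (hp r hr.1 hr.2).trans ?_
      have := hNanti (le_of_lt hr.2 : s ≤ r)
      have := hφ0 r
      gcongr
  intro s hs
  rw [← norm_le_zero_iff]
  refine le_of_forall_pos_le_add fun ε hε => ?_
  have h3 : 0 < (1 + N s) * φ s := mul_pos (by linarith [hN0 s]) (Real.exp_pos _)
  have := key (ε / ((1 + N s) * φ s)) (by positivity) s hs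
  rw [mul_assoc, div_mul_cancel₀ _ h3.ne'] at this
  linarith

/-! ### Generalized monomials. -/

/-- `sInf (S ∩ Ici r)` fixes the points of `S` and sends a gap to its right end, the value a nabla
integral uses there. -/
lemma nextPoint_mem {S : Set ℝ} (hS : IsClosed S) {b r : ℝ} (hb : b ∈ S) (hr : r ≤ b) :
    sInf (S ∩ Ici r) ∈ S ∩ Ici r :=
  (hS.inter isClosed_Ici).csInf_mem ⟨b, hb, hr⟩ ⟨r, fun _ hx => hx.2⟩

lemma nextPoint_le {S : Set ℝ} {r s : ℝ} (hs : s ∈ S) (hr : r ≤ s) : sInf (S ∩ Ici r) ≤ s :=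
  csInf_le ⟨r, fun _ hx => hx.2⟩ ⟨hs, hr⟩

lemma nextPoint_mono {S : Set ℝ} (hS : IsClosed S) {b r r' : ℝ} (hb : b ∈ S) (hr : r' ≤ b)
    (h : r ≤ r') : sInf (S ∩ Ici r) ≤ sInf (S ∩ Ici r') :=
  nextPoint_le (nextPoint_mem hS hb hr).1 (h.trans (nextPoint_mem hS hb hr).2)

/-- The generalized monomials of the time scale `S`, centred at `b`: up to the sign `(-1) ^ k`
these are the `k`-fold iterated nabla integrals of `1`, a nabla integral being the Lebesgue
integral of the extension that is constant on the gaps. -/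
noncomputable def monomial (S : Set ℝ) (b : ℝ) : ℕ → ℝ → ℝ
  | 0 => fun _ => 1
  | k + 1 => fun t => ∫ r in t..b, monomial S b k (sInf (S ∩ Ici r))

section monomial

variable {S : Set ℝ} {b : ℝ}

lemma monomial_succ (k : ℕ) (t : ℝ) :
    monomial S b (k + 1) t = ∫ r in t..b, monomial S b k (sInf (S ∩ Ici r)) := rfl

@[simp] lemma monomial_zero (t : ℝ) : monomial S b 0 t = 1 := rfl

@[simp] lemma monomial_succ_self (k : ℕ) : monomial S b (k + 1) b = 0 := by
  simp [monomial_succ]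

lemma antitoneOn_comp_nextPoint (hS : IsClosed S) (hb : b ∈ S) {f : ℝ → ℝ}
    (hf : AntitoneOn f (Iic b)) : AntitoneOn (fun r => f (sInf (S ∩ Ici r))) (Iic b) :=
  fun _ hx _ hy hxy => hf (nextPoint_le hb hx) (nextPoint_le hb hy) (nextPoint_mono hS hb hy hxy)

lemma intervalIntegrable_comp_nextPoint (hS : IsClosed S) (hb : b ∈ S) {f : ℝ → ℝ}
    (hf : AntitoneOn f (Iic b)) {x y : ℝ} (hx : x ≤ b) (hy : y ≤ b) :
    IntervalIntegrable (fun r => f (sInf (S ∩ Ici r))) MeasureTheory.volume x y :=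
  ((antitoneOn_comp_nextPoint hS hb hf).mono
    fun _ hr => hr.2.trans (max_le hx hy)).intervalIntegrable

/-- The claims need a joint induction: monotonicity gives integrability of the next integrand,
nonnegativity gives its monotonicity. Moving `r` to its next point only decreases `(b - r) ^ k`, so
the monomials of ℝ are upper bounds. -/
lemma monomial_antitoneOn_and_bounds (hS : IsClosed S) (hb : b ∈ S) (k : ℕ) :
    AntitoneOn (monomial S b k) (Iic b) ∧
      ∀ t ≤ b, 0 ≤ monomial S b k t ∧ monomial S b k t ≤ (b - t) ^ k / k.factorial := by
  induction k with
  | zero => exact ⟨fun _ _ _ _ _ => le_rfl, fun t _ => by simp⟩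
  | succ k ih =>
    obtain ⟨hanti, hbd⟩ := ih
    have hnn : ∀ r ≤ b, 0 ≤ monomial S b k (sInf (S ∩ Ici r)) := fun r hr =>
      (hbd _ (nextPoint_le hb hr)).1
    refine ⟨fun x hx y hy hxy => ?_, fun t ht => ⟨?_, ?_⟩⟩
    · have h := intervalIntegral.integral_add_adjacent_intervals
        (intervalIntegrable_comp_nextPoint hS hb hanti hx hy)
        (intervalIntegrable_comp_nextPoint hS hb hanti hy le_rfl)
      have h' : 0 ≤ ∫ r in x..y, monomial S b k (sInf (S ∩ Ici r)) :=
        intervalIntegral.integral_nonneg hxy fun r hr => hnn r (hr.2.trans hy)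
      rw [monomial_succ, monomial_succ]
      linarith
    · exact intervalIntegral.integral_nonneg ht fun r hr => hnn r hr.2
    · rw [monomial_succ]
      have h1 : ∫ r in t..b, monomial S b k (sInf (S ∩ Ici r)) ≤
          ∫ r in t..b, (b - r) ^ k / k.factorial := by
        refine intervalIntegral.integral_mono_on ht
          (intervalIntegrable_comp_nextPoint hS hb hanti ht le_rfl)
          (Continuous.intervalIntegrable (by fun_prop) _ _) fun r hr => ?_
        have hm := nextPoint_mem hS hb hr.2
        have hle := nextPoint_le (S := S) hb hr.2
        refine (hbd _ hle).2.trans ?_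
        have h2 : r ≤ sInf (S ∩ Ici r) := hm.2
        have : 0 ≤ b - sInf (S ∩ Ici r) := by linarith
        gcongr
      refine h1.trans_eq ?_
      rw [intervalIntegral.integral_div,
        intervalIntegral.integral_comp_sub_left (fun r => r ^ k) b, integral_pow]
      rw [Nat.factorial_succ]
      push_cast
      have : (k.factorial : ℝ) ≠ 0 := by positivity
      have : (k + 1 : ℝ) ≠ 0 := by positivity
      field_simp
      simp

lemma monomial_succ_sub (hS : IsClosed S) (hb : b ∈ S) (k : ℕ) {τ s : ℝ} (hτ : τ ≤ b)
    (hs : s ≤ b) : monomial S b (k + 1) τ - monomial S b (k + 1) s =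
      ∫ r in τ..s, monomial S b k (sInf (S ∩ Ici r)) := by
  have hanti := (monomial_antitoneOn_and_bounds hS hb k).1
  rw [monomial_succ, monomial_succ, ← intervalIntegral.integral_add_adjacent_intervals
        (intervalIntegrable_comp_nextPoint hS hb hanti hτ hs)
        (intervalIntegrable_comp_nextPoint hS hb hanti hs le_rfl)]
  ring

lemma monomial_succ_sub_le (hS : IsClosed S) (hb : b ∈ S) (k : ℕ) {τ s : ℝ} (h : τ ≤ s)
    (hs : s ≤ b) :
    monomial S b (k + 1) τ - monomial S b (k + 1) s ≤ (s - τ) * monomial S b k τ := by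
  have hanti := (monomial_antitoneOn_and_bounds hS hb k).1
  rw [monomial_succ_sub hS hb k (h.trans hs) hs]
  have : ∫ r in τ..s, monomial S b k (sInf (S ∩ Ici r)) ≤ ∫ r in τ..s, monomial S b k τ := by
    refine intervalIntegral.integral_mono_on h
      (intervalIntegrable_comp_nextPoint hS hb hanti (h.trans hs) hs)
      intervalIntegrable_const fun r hr => ?_
    have hrb := hr.2.trans hs
    exact hanti (h.trans hs) (nextPoint_le hb hrb) (hr.1.trans (nextPoint_mem hS hb hrb).2)
  simpa using this

/-- `s ∈ S` prevents the next point of any `r ≤ s` from passing `s`. -/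
lemma le_monomial_succ_sub (hS : IsClosed S) (hb : b ∈ S) (k : ℕ) {τ s : ℝ} (h : τ ≤ s)
    (hs : s ≤ b) (hsS : s ∈ S) :
    (s - τ) * monomial S b k s ≤ monomial S b (k + 1) τ - monomial S b (k + 1) s := by
  have hanti := (monomial_antitoneOn_and_bounds hS hb k).1
  rw [monomial_succ_sub hS hb k (h.trans hs) hs]
  have : ∫ r in τ..s, monomial S b k s ≤ ∫ r in τ..s, monomial S b k (sInf (S ∩ Ici r)) := by
    refine intervalIntegral.integral_mono_on h intervalIntegrable_const
      (intervalIntegrable_comp_nextPoint hS hb hanti (h.trans hs) hs) fun r hr => ?_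
    exact hanti (nextPoint_le hb (hr.2.trans hs)) hs (nextPoint_le hsS hr.2)
  simpa using this

lemma monomial_succ_sub_of_gap (hS : IsClosed S) (hb : b ∈ S) (k : ℕ) {τ s : ℝ} (h : τ ≤ s)
    (hs : s ≤ b) (hsS : s ∈ S) (hgap : ∀ r ∈ S, τ < r → s ≤ r) :
    monomial S b (k + 1) τ - monomial S b (k + 1) s = (s - τ) * monomial S b k s := by
  rw [monomial_succ_sub hS hb k (h.trans hs) hs]
  have : ∫ r in τ..s, monomial S b k (sInf (S ∩ Ici r)) = ∫ r in τ..s, monomial S b k s := by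
    refine intervalIntegral.integral_congr_ae (Eventually.of_forall fun r hr => ?_)
    rw [uIoc_of_le h] at hr
    have hm := nextPoint_mem hS hb (hr.2.trans hs)
    rw [le_antisymm (nextPoint_le hsS hr.2) (hgap _ hm.1 (hr.1.trans_le hm.2))]
  simpa using this

/-- The constant is `L ^ (k - 1) / (k - 1)!` for `k ≥ 1` and `0` for `k = 0`, in one formula. -/
lemma abs_monomial_sub_le (hS : IsClosed S) (hb : b ∈ S) {a L : ℝ} (hL : b - a ≤ L) (k : ℕ)
    {τ s : ℝ} (hτ : τ ∈ Icc a b) (hs : s ∈ Icc a b) :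
    |monomial S b k τ - monomial S b k s| ≤ |s - τ| * (k * L ^ (k - 1) / k.factorial) := by
  cases k with
  | zero => simp
  | succ k =>
    wlog h : τ ≤ s generalizing τ s
    · rw [abs_sub_comm, abs_sub_comm s]
      exact this hs hτ (le_of_not_ge h)
    obtain ⟨hanti, -⟩ := monomial_antitoneOn_and_bounds hS hb (k + 1)
    rw [abs_of_nonneg (sub_nonneg.2 (hanti hτ.2 hs.2 h)), abs_of_nonneg (sub_nonneg.2 h)]
    refine (monomial_succ_sub_le hS hb k h hs.2).trans ?_
    have h1 := ((monomial_antitoneOn_and_bounds hS hb k).2 τ hτ.2).2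
    have h0 : 0 ≤ b - τ := by linarith [hτ.2]
    have e : ((k + 1 : ℕ) : ℝ) * L ^ (k + 1 - 1) / (k + 1).factorial = L ^ k / k.factorial := by
      rw [Nat.factorial_succ]; push_cast
      have : (k.factorial : ℝ) ≠ 0 := by positivity
      have : (k + 1 : ℝ) ≠ 0 := by positivity
      field_simp
    rw [e]
    refine mul_le_mul_of_nonneg_left (h1.trans ?_) (sub_nonneg.2 h)
    gcongr
    linarith [hτ.1]

/-- The increment lies between `s - τ` times the two end values of the antitone `monomial S b k`,
whose difference is again of order `s - τ`. -/
lemma abs_monomial_error_le (hS : IsClosed S) (hb : b ∈ S) {a L : ℝ} (hL : b - a ≤ L) (k : ℕ)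
    {τ s : ℝ} (hτ : τ ∈ Icc a b) (hs : s ∈ Icc a b) (hτS : τ ∈ S) (hsS : s ∈ S) :
    |monomial S b (k + 1) τ - monomial S b (k + 1) s - (s - τ) * monomial S b k s| ≤
      (s - τ) ^ 2 * (k * L ^ (k - 1) / k.factorial) := by
  have h1 := abs_monomial_sub_le hS hb hL k hτ hs
  have h2 : |monomial S b (k + 1) τ - monomial S b (k + 1) s - (s - τ) * monomial S b k s| ≤
      |s - τ| * |monomial S b k τ - monomial S b k s| := by
    rw [← abs_mul, mul_sub]
    rcases le_total τ s with h | h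
    · have h3 := monomial_succ_sub_le hS hb k h hs.2
      have h4 := le_monomial_succ_sub hS hb k h hs.2 hsS
      exact abs_le_abs_of_nonneg (by linarith) (by linarith)
    · have h3 := monomial_succ_sub_le hS hb k h hτ.2
      have h4 := le_monomial_succ_sub hS hb k h hτ.2 hτS
      rw [abs_of_nonneg (by linarith), abs_of_nonneg (by linarith)]
      linarith
  refine h2.trans ((mul_le_mul_of_nonneg_left h1 (abs_nonneg _)).trans_eq ?_)
  rw [← mul_assoc, abs_mul_abs_self, sq]

end monomial

/-! ### The series `psi`. -/

/-- The constant in the second order estimate for `psi`. -/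
noncomputable def psiConst {𝔸 : Type*} [NormedRing 𝔸] (X : 𝔸) (L : ℝ) : ℝ := ∑' k : ℕ, k * L ^ (k - 1) / k.factorial * ‖X‖ ^ k

lemma summable_psiConst {𝔸 : Type*} [NormedRing 𝔸] (X : 𝔸) (L : ℝ) :
    Summable fun k : ℕ => (k * L ^ (k - 1) / k.factorial : ℝ) * ‖X‖ ^ k := by
  rw [← summable_nat_add_iff 1]
  have h := (Real.summable_pow_div_factorial (L * ‖X‖)).mul_right ‖X‖
  refine h.congr fun k => ?_
  rw [Nat.factorial_succ]
  push_cast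
  have : (k.factorial : ℝ) ≠ 0 := by positivity
  have : (k + 1 : ℝ) ≠ 0 := by positivity
  simp only [mul_pow]
  field_simp
  rw [pow_succ, mul_assoc]

lemma psiConst_nonneg {𝔸 : Type*} [NormedRing 𝔸] (X : 𝔸) {L : ℝ} (hL : 0 ≤ L) : 0 ≤ psiConst X L :=
  tsum_nonneg fun k => by positivity

section resolvent

variable {𝔸 : Type*} [NormedRing 𝔸] [NormedAlgebra ℝ 𝔸]

/-- The solution `Ψ` of `Ψ^∇ = 1 + X Ψ` on the time scale `S` with `Ψ b = 0`; the transition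
operator of `X` is `1 + X Ψ`. -/
noncomputable def psi (S : Set ℝ) (X : 𝔸) (b t : ℝ) : 𝔸 :=
  ∑' k : ℕ, ((-1) ^ (k + 1) * monomial S b (k + 1) t) • X ^ k

variable {S : Set ℝ} {a b : ℝ} (X : 𝔸)

@[simp] lemma psi_self : psi S X b b = 0 := by simp [psi]

variable [NormOneClass 𝔸] [CompleteSpace 𝔸]

lemma summable_monomial_smul (hS : IsClosed S) (hb : b ∈ S) {t : ℝ} (ht : t ≤ b) :
    Summable fun k : ℕ => ((-1) ^ k * monomial S b k t) • X ^ k := by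
  refine Summable.of_norm_bounded (Real.summable_pow_div_factorial ((b - t) * ‖X‖)) fun k => ?_
  obtain ⟨h0, h1⟩ := (monomial_antitoneOn_and_bounds hS hb k).2 t ht
  rw [norm_smul, norm_mul, norm_pow, norm_neg, norm_one, one_pow, one_mul, Real.norm_eq_abs,
    abs_of_nonneg h0, mul_pow, mul_div_right_comm]
  gcongr
  exact norm_pow_le X k

lemma summable_psi (hS : IsClosed S) (hb : b ∈ S) {t : ℝ} (ht : t ≤ b) :
    Summable fun k : ℕ => ((-1) ^ (k + 1) * monomial S b (k + 1) t) • X ^ k := by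
  refine Summable.of_norm_bounded
    ((Real.summable_pow_div_factorial ((b - t) * ‖X‖)).mul_left (b - t)) fun k => ?_
  obtain ⟨h0, h1⟩ := (monomial_antitoneOn_and_bounds hS hb (k + 1)).2 t ht
  have hbt : 0 ≤ b - t := sub_nonneg.2 ht
  rw [norm_smul, norm_mul, norm_pow, norm_neg, norm_one, one_pow, one_mul, Real.norm_eq_abs,
    abs_of_nonneg h0]
  calc _ ≤ (b - t) ^ (k + 1) / (k + 1).factorial * ‖X‖ ^ k := by
        gcongr
        exact norm_pow_le X k
    _ ≤ (b - t) ^ (k + 1) / k.factorial * ‖X‖ ^ k := by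
        gcongr
        omega
    _ = _ := by rw [mul_pow]; ring

lemma one_add_mul_psi (hS : IsClosed S) (hb : b ∈ S) {t : ℝ} (ht : t ≤ b) :
    1 + X * psi S X b t = ∑' k : ℕ, ((-1) ^ k * monomial S b k t) • X ^ k := by
  rw [(summable_monomial_smul X hS hb ht).tsum_eq_zero_add, psi,
    ← (summable_psi X hS hb ht).tsum_mul_left]
  simp [pow_succ']

lemma psi_error_eq (hS : IsClosed S) (hb : b ∈ S) {τ s : ℝ} (hτ : τ ≤ b) (hs : s ≤ b) :
    psi S X b s - psi S X b τ - (s - τ) • (1 + X * psi S X b s) =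
      ∑' k : ℕ, ((-1) ^ k * (monomial S b (k + 1) τ - monomial S b (k + 1) s
        - (s - τ) * monomial S b k s)) • X ^ k := by
  rw [one_add_mul_psi X hS hb hs, psi, psi,
    ← (summable_psi X hS hb hs).tsum_sub (summable_psi X hS hb hτ),
    ← (summable_monomial_smul X hS hb hs).tsum_const_smul,
    ← ((summable_psi X hS hb hs).sub (summable_psi X hS hb hτ)).tsum_sub
      ((summable_monomial_smul X hS hb hs).const_smul _)]
  refine tsum_congr fun k => ?_
  rw [← sub_smul, smul_smul, ← sub_smul]
  congr 1
  ring

/-- A constant independent of `τ`, `s` and `b` makes this serve both the derivative at left-dense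
points and the difference quotients of steps at points `c ↓ a`. -/
lemma norm_psi_error_le (hS : IsClosed S) (hb : b ∈ S) {L : ℝ} (hL : b - a ≤ L) {τ s : ℝ}
    (hτ : τ ∈ Icc a b) (hs : s ∈ Icc a b) (hτS : τ ∈ S) (hsS : s ∈ S) :
    ‖psi S X b s - psi S X b τ - (s - τ) • (1 + X * psi S X b s)‖ ≤
      psiConst X L * (s - τ) ^ 2 := by
  rw [psi_error_eq X hS hb hτ.2 hs.2, mul_comm]
  refine tsum_of_norm_bounded (((summable_psiConst X L).hasSum).mul_left _) fun k => ?_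
  rw [norm_smul, norm_mul, norm_pow, norm_neg, norm_one, one_pow, one_mul, Real.norm_eq_abs,
    ← mul_assoc]
  exact mul_le_mul (abs_monomial_error_le hS hb hL k hτ hs hτS hsS) (norm_pow_le X k)
    (norm_nonneg _) ((abs_nonneg _).trans (abs_monomial_error_le hS hb hL k hτ hs hτS hsS))

lemma psi_sub_of_gap (hS : IsClosed S) (hb : b ∈ S) {τ s : ℝ} (h : τ ≤ s)
    (hs : s ≤ b) (hsS : s ∈ S) (hgap : ∀ r ∈ S, τ < r → s ≤ r) :
    psi S X b s - psi S X b τ = (s - τ) • (1 + X * psi S X b s) := by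
  rw [← sub_eq_zero, psi_error_eq X hS hb (h.trans hs) hs]
  simp [monomial_succ_sub_of_gap hS hb _ h hs hsS hgap]

lemma continuousOn_psi (hS : IsClosed S) (hb : b ∈ S) (a : ℝ) :
    ContinuousOn (psi S X b) (S ∩ Icc a b) := by
  intro s hs
  rw [ContinuousWithinAt, tendsto_iff_norm_sub_tendsto_zero]
  have hlim : Tendsto (fun τ => psiConst X (b - a) * (s - τ) ^ 2 +
      |s - τ| * ‖1 + X * psi S X b s‖) (𝓝[S ∩ Icc a b] s) (𝓝 0) := by
    have : Continuous fun τ => psiConst X (b - a) * (s - τ) ^ 2 +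
      |s - τ| * ‖1 + X * psi S X b s‖ := by fun_prop
    have := (this.tendsto s).mono_left (nhdsWithin_le_nhds (s := S ∩ Icc a b))
    simpa using this
  refine squeeze_zero' (Eventually.of_forall fun _ => norm_nonneg _) ?_ hlim
  filter_upwards [self_mem_nhdsWithin] with τ hτ
  rw [norm_sub_rev]
  have h1 := norm_psi_error_le X hS hb le_rfl hτ.2 hs.2 hτ.1 hs.1
  have h2 := norm_add_le (psi S X b s - psi S X b τ - (s - τ) • (1 + X * psi S X b s))
    ((s - τ) • (1 + X * psi S X b s))
  rw [sub_add_cancel, norm_smul, Real.norm_eq_abs] at h2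
  linarith

end resolvent

/-! ### Responses to step controls. -/

/-- A real square matrix as a continuous linear operator. -/
noncomputable abbrev op {n : ℕ} (A : Matrix (Fin n) (Fin n) ℝ) :
    (Fin n → ℝ) →L[ℝ] (Fin n → ℝ) :=
  LinearMap.toContinuousLinearMap A.mulVecLin

lemma isClosed_interval {T : Set ℝ} (hT : IsClosed T) (a b : ℝ) : IsClosed (interval T a b) :=
  isClosed_Icc.inter hT

lemma isClosed_dual {T : Set ℝ} (hT : IsClosed T) : IsClosed (dual T) :=
  hT.preimage continuous_neg

lemma eventually_le_of_notMem_closure {S : Set ℝ} {b : ℝ} (h : b ∉ closure (S ∩ Ioi b)) :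
    ∀ᶠ τ in 𝓝[S] b, τ ≤ b := by
  have h1 : (closure (S ∩ Ioi b))ᶜ ∈ 𝓝 b := isClosed_closure.isOpen_compl.mem_nhds h
  filter_upwards [mem_nhdsWithin_of_mem_nhds h1, self_mem_nhdsWithin] with τ h2 h3
  by_contra hlt
  exact h2 (subset_closure ⟨h3, not_le.1 hlt⟩)

/-- Within half the jump of `s`, the factor `|ρ(s) - τ|` stays at least half the jump, so continuity
controls the error. -/
lemma hasNablaDerivAt_of_leftScattered {n : ℕ} {S : Set ℝ} {f : ℝ → Fin n → ℝ} {d : Fin n → ℝ}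
    {s : ℝ} (hlt : backwardJump S s < s)
    (hjump : f s - f (backwardJump S s) = (s - backwardJump S s) • d)
    (hf : ContinuousWithinAt f S s) : HasNablaDerivAt S f d s := by
  intro ε hε
  set r := backwardJump S s
  have hν : 0 < s - r := sub_pos.2 hlt
  have hlim : ContinuousWithinAt (fun τ => ‖f s - f τ - (s - τ) • d‖) S s := by fun_prop
  have hlim' : ∀ᶠ τ in 𝓝[S] s, ‖f s - f τ - (s - τ) • d‖ < ε * ((s - r) / 2) := by
    refine hlim.tendsto.eventually_lt_const ?_
    simp only [sub_self, zero_smul, norm_zero]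
    positivity
  obtain ⟨δ, hδ, h⟩ := Metric.mem_nhdsWithin_iff.1 hlim'
  refine ⟨min δ ((s - r) / 2), lt_min hδ (by positivity), fun τ hτ hd => ?_⟩
  have h1 := h ⟨by rw [Metric.mem_ball, Real.dist_eq]; exact hd.trans_le (min_le_left _ _), hτ⟩
  have h2 := (abs_lt.1 (hd.trans_le (min_le_right _ _))).1
  have e : f r - f τ - (r - τ) • d = f s - f τ - (s - τ) • d := by
    have : f r = f s - (s - r) • d := by rw [← hjump]; abel
    rw [this]; module
  rw [e]
  refine (le_of_lt h1).trans ?_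
  gcongr
  rw [abs_sub_comm]
  exact (by linarith : (s - r) / 2 ≤ τ - r).trans (le_abs_self _)

lemma hasNablaDerivAt_of_sq_bound {n : ℕ} {S : Set ℝ} {f : ℝ → Fin n → ℝ} {d : Fin n → ℝ}
    {s : ℝ} (hs : backwardJump S s = s) {C : ℝ} (hC : 0 ≤ C)
    (h : ∀ᶠ τ in 𝓝[S] s, ‖f s - f τ - (s - τ) • d‖ ≤ C * (s - τ) ^ 2) :
    HasNablaDerivAt S f d s := by
  intro ε hε
  obtain ⟨δ, hδ, h⟩ := Metric.mem_nhdsWithin_iff.1 h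
  refine ⟨min δ (ε / (C + 1)), lt_min hδ (by positivity), fun τ hτ hd => ?_⟩
  have h1 := h ⟨by rw [Metric.mem_ball, Real.dist_eq]; exact hd.trans_le (min_le_left _ _), hτ⟩
  have h2 := hd.trans_le (min_le_right _ _)
  rw [hs]
  refine (mem_ofPred.1 h1).trans ?_
  rw [← sq_abs, sq, ← mul_assoc]
  gcongr
  rw [abs_sub_comm, lt_div_iff₀ (by positivity)] at h2
  nlinarith [abs_nonneg (s - τ)]

lemma HasNablaDerivAt.restrict_Iic {n : ℕ} {S : Set ℝ} {f : ℝ → Fin n → ℝ} {d : Fin n → ℝ}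
    {s c : ℝ} (h : HasNablaDerivAt S f d s) (hc : s ≤ c) :
    HasNablaDerivAt (S ∩ Iic c) f d s := by
  have e : backwardJump (S ∩ Iic c) s = backwardJump S s := by
    have : S ∩ Iic c ∩ Iio s = S ∩ Iio s := by
      ext x
      exact ⟨fun hx => ⟨hx.1.1, hx.2⟩, fun hx => ⟨⟨hx.1, (le_of_lt hx.2).trans hc⟩, hx.2⟩⟩
    unfold backwardJump
    rw [this]
  intro ε hε
  obtain ⟨δ, hδ, hh⟩ := h ε hε
  exact ⟨δ, hδ, fun τ hτ hlt => by rw [e]; exact hh τ hτ.1 hlt⟩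

section psi

variable {n : ℕ} [NeZero n] {S : Set ℝ} {a c b : ℝ} (X : (Fin n → ℝ) →L[ℝ] (Fin n → ℝ))
  (x : Fin n → ℝ)

lemma continuousOn_psi_min (hS : IsClosed S) (hsub : S ⊆ Icc a c) (hb : b ∈ S) :
    ContinuousOn (fun t => psi S X b (min t b) x) S := by
  have h1 : ContinuousOn (fun t => psi S X b (min t b)) S := by
    refine (continuousOn_psi X hS hb a).comp (by fun_prop) fun t ht => ?_
    refine ⟨?_, le_min (hsub ht).1 (hsub hb).1, min_le_right _ _⟩
    rcases min_choice t b with h | h <;> rw [h] <;> assumption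
  exact h1.clm_apply continuousOn_const

/-- The `min` extends the response by `0` beyond `b`. Only a left-dense `b` that is also a limit
from the right causes trouble: the two one-sided slopes there differ by `x`. -/
lemma hasNablaDerivAt_psi_min (hS : IsClosed S) (hsub : S ⊆ Icc a c) (hb : b ∈ S) {s : ℝ}
    (hs : s ∈ S) (hex : ∃ τ ∈ S, τ < s)
    (hsb : IsLeftDense S s → s = b → b ∈ closure (S ∩ Ioi b) → x = 0) :
    HasNablaDerivAt S (fun t => psi S X b (min t b) x)
      (X (psi S X b (min s b) x) + if s ≤ b then x else 0) s := by
  have hval : ∀ t, b ≤ t → psi S X b (min t b) x = 0 := fun t ht => by simp [ht]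
  rcases (backwardJump_le hex).lt_or_eq with hlt | heq
  · refine hasNablaDerivAt_of_leftScattered hlt ?_ (continuousOn_psi_min X x hS hsub hb s hs)
    by_cases h : s ≤ b
    · rw [if_pos h, min_eq_left h, min_eq_left (hlt.le.trans h)]
      have := psi_sub_of_gap X hS hb hlt.le h hs fun r hr hlt' =>
        not_lt.1 fun h' => (le_backwardJump hr h').not_gt hlt'
      have := congrArg (fun M : (Fin n → ℝ) →L[ℝ] (Fin n → ℝ) => M x) this
      simp only [sub_apply, smul_apply,
        add_apply, one_apply_eq_self,
        mul_apply_eq_comp] at this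
      rw [this, add_comm x]
    · have h := not_le.1 h
      rw [if_neg h.not_ge, hval s h.le, hval _ (le_backwardJump hb h)]
      simp
  · have hld : IsLeftDense S s := ⟨hs, hex, heq⟩
    have hC : 0 ≤ psiConst X (b - a) * ‖x‖ :=
      mul_nonneg (psiConst_nonneg X (sub_nonneg.2 ((hsub hb).1))) (norm_nonneg x)
    refine hasNablaDerivAt_of_sq_bound heq hC ?_
    have key : ∀ τ ∈ S, τ ≤ b → s ≤ b → ‖psi S X b (min s b) x - psi S X b (min τ b) x -
        (s - τ) • (X (psi S X b (min s b) x) + if s ≤ b then x else 0)‖ ≤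
        psiConst X (b - a) * ‖x‖ * (s - τ) ^ 2 := by
      intro τ hτ hτb h
      rw [if_pos h, min_eq_left h, min_eq_left hτb]
      have h1 := norm_psi_error_le X hS hb le_rfl ⟨(hsub hτ).1, hτb⟩ ⟨(hsub hs).1, h⟩ hτ hs
      have h2 := ContinuousLinearMap.le_opNorm
        (psi S X b s - psi S X b τ - (s - τ) • (1 + X * psi S X b s)) x
      simp only [sub_apply, smul_apply,
        add_apply, one_apply_eq_self,
        mul_apply_eq_comp] at h2
      rw [add_comm _ x, mul_right_comm]
      exact h2.trans (mul_le_mul_of_nonneg_right h1 (norm_nonneg x))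
    rcases lt_trichotomy s b with h | h | h
    · filter_upwards [mem_nhdsWithin_of_mem_nhds (Iio_mem_nhds h), self_mem_nhdsWithin] with τ h1 h2
      exact key τ h2 (le_of_lt h1) h.le
    · by_cases hcl : b ∈ closure (S ∩ Ioi b)
      · simp [hsb hld h hcl]
      · have := eventually_le_of_notMem_closure hcl
        rw [← h] at this
        filter_upwards [this, self_mem_nhdsWithin] with τ h1 h2
        exact key τ h2 (h1.trans h.le) h.le
    · filter_upwards [mem_nhdsWithin_of_mem_nhds (Ioi_mem_nhds h)] with τ h1
      rw [if_neg h.not_ge, hval s h.le, hval τ (le_of_lt h1)]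
      simp only [sub_self, map_zero, add_zero, smul_zero, norm_zero]
      exact mul_nonneg hC (sq_nonneg _)

/-- The cocycle identity for `psi`. -/
lemma psi_apply_eq (hS : IsClosed S) (hsub : S ⊆ Icc a c) {α β : ℝ} (hα : α ∈ S) (hβ : β ∈ S)
    (hαβ : α < β) {t : ℝ} (ht : t ∈ S) (htα : t ≤ α) :
    psi S X β t x = psi S X β α x + psi S X α t (x + X (psi S X β α x)) := by
  set q := psi S X β α x with hq
  set z : ℝ → Fin n → ℝ := fun t =>
    psi S X β (min t β) x - (psi S X α (min t α) (x + X q) + q) with hz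
  have hS' : IsClosed (S ∩ Iic α) := hS.inter isClosed_Iic
  have hcont : ContinuousOn z S := (continuousOn_psi_min X x hS hsub hβ).sub
    ((continuousOn_psi_min X _ hS hsub hα).add continuousOn_const)
  -- Both sides solve the same equation below `α` and agree at `α`. The point `α` is made
  -- exceptional because the response switched on there may lack a derivative.
  have := eq_zero_of_nablaDeriv_le hS' (a := a) (b := α)
    (fun s hs => ⟨(hsub hs.1).1, hs.2⟩) ⟨hα, le_refl α⟩ (z := z) (d := fun s => X (z s))
    (hcont.mono inter_subset_left) ?_ (finite_singleton α) (norm_nonneg X) ?_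
    (fun s _ => X.le_opNorm _) t ⟨ht, htα⟩
  · rw [hz] at this
    simp only [min_eq_left htα, min_eq_left (htα.trans hαβ.le)] at this
    rw [sub_eq_zero.1 this, add_comm]
  · simp [hz, min_eq_left hαβ.le, hq]
  · intro s hs hex hF
    have hsα : s ≤ α := hs.2
    have hex' : ∃ τ ∈ S, τ < s := by
      obtain ⟨τ, h, h'⟩ := hex
      exact ⟨τ, h.1, h'⟩
    have hld : IsLeftDense S s → IsLeftDense (S ∩ Iic α) s := by
      intro h
      refine ⟨hs, hex, ?_⟩
      refine le_antisymm (backwardJump_le hex) (le_of_forall_lt fun r hr => ?_)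
      rw [← h.2.2, backwardJump_of_exists hex'] at hr
      obtain ⟨y, hy, hry⟩ := exists_lt_of_lt_csSup (s := S ∩ Iio s) hex' hr
      exact hry.trans_le (le_backwardJump ⟨hy.1, (le_of_lt hy.2).trans hsα⟩ hy.2)
    have h1 := hasNablaDerivAt_psi_min X x hS hsub hβ hs.1 hex'
      fun _ h => absurd h (hsα.trans_lt hαβ).ne
    have h2 := hasNablaDerivAt_psi_min X (x + X q) hS hsub hα hs.1 hex'
      fun h h' => absurd h' (hF (hld h))
    have h3 := (h1.sub (h2.add (hasNablaDerivAt_const q))).restrict_Iic hsα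
    rw [if_pos (hsα.trans hαβ.le), if_pos hsα] at h3
    convert h3 using 1
    simp only [hz, map_sub, map_add]
    abel

end psi

lemma tendsto_step_right {m : ℕ} (S : Set ℝ) (b s : ℝ) (u : Fin m → ℝ) :
    Tendsto (fun t => if t ≤ b then u else 0) (𝓝[S ∩ Ioi s] s) (𝓝 (if s < b then u else 0)) := by
  refine tendsto_nhds_of_eventually_eq ?_
  by_cases h : s < b
  · filter_upwards [mem_nhdsWithin_of_mem_nhds (Iio_mem_nhds h)] with τ h1
    rw [if_pos h, if_pos (le_of_lt h1)]
  · filter_upwards [self_mem_nhdsWithin] with τ h1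
    rw [if_neg h, if_neg (not_le.2 ((not_lt.1 h).trans_lt h1.2))]

lemma tendsto_step_left {m : ℕ} (S : Set ℝ) (b s : ℝ) (u : Fin m → ℝ) :
    Tendsto (fun t => if t ≤ b then u else 0) (𝓝[S ∩ Iio s] s) (𝓝 (if s ≤ b then u else 0)) := by
  refine tendsto_nhds_of_eventually_eq ?_
  by_cases h : s ≤ b
  · filter_upwards [self_mem_nhdsWithin] with τ h1
    rw [if_pos h, if_pos ((le_of_lt h1.2).trans h)]
  · filter_upwards [mem_nhdsWithin_of_mem_nhds (Ioi_mem_nhds (not_le.1 h))] with τ h1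
    rw [if_neg h, if_neg (not_le.2 h1)]

lemma continuousWithinAt_step {m : ℕ} (S : Set ℝ) {b s : ℝ} (u : Fin m → ℝ) (h : s ≠ b) :
    ContinuousWithinAt (fun t => if t ≤ b then u else 0) S s := by
  refine ContinuousAt.continuousWithinAt (tendsto_nhds_of_eventually_eq ?_)
  rcases h.lt_or_gt with h | h
  · filter_upwards [Iio_mem_nhds h] with τ h1
    rw [if_pos h.le, if_pos (le_of_lt h1)]
  · filter_upwards [Ioi_mem_nhds h] with τ h1
    rw [if_neg h.not_ge, if_neg (not_le.2 h1)]

lemma eq_zero_of_continuousWithinAt_step {m : ℕ} {S : Set ℝ} {b : ℝ} {u : Fin m → ℝ}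
    (h : ContinuousWithinAt (fun t => if t ≤ b then u else 0) S b)
    (hb : b ∈ closure (S ∩ Ioi b)) : u = 0 := by
  have hne : (𝓝[S ∩ Ioi b] b).NeBot := mem_closure_iff_nhdsWithin_neBot.1 hb
  have h1 := (h.mono (inter_subset_left (t := Ioi b))).tendsto
  simpa using tendsto_nhds_unique h1 (tendsto_step_right S b b u)

/-- The points reached by step controls with finitely many steps. -/
theorem mem_reachableSet_of_step {n m : ℕ} [NeZero n] {T : Set ℝ} (hT : IsClosed T)
    (A : Matrix (Fin n) (Fin n) ℝ) (B : Matrix (Fin n) (Fin m) ℝ) (y₀ : Fin n → ℝ) {s₁ s₀ : ℝ}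
    (hs₁ : s₁ ∈ interval T s₁ s₀) (hs₀ : s₀ ∈ interval T s₁ s₀) (F : Finset ℝ)
    (hF : ∀ b ∈ F, b ∈ interval T s₁ s₀) (u : ℝ → Fin m → ℝ) :
    y₀ + psi (interval T s₁ s₀) (op A) s₀ s₁ (op A y₀) +
      ∑ b ∈ F, psi (interval T s₁ s₀) (op A) b s₁ (B.mulVec (u b)) ∈
      reachableSet T A B y₀ s₁ s₀ := by
  set S := interval T s₁ s₀ with hSdef
  have hS : IsClosed S := isClosed_interval hT _ _
  have hsub : S ⊆ Icc s₁ s₀ := inter_subset_left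
  set w : ℝ → ℝ → Fin m → ℝ := fun b t => if t ≤ b then u b else 0 with hw
  set v : ℝ → Fin m → ℝ := fun t => ∑ b ∈ F, w b t with hv
  set y : ℝ → Fin n → ℝ := fun t => y₀ + psi S (op A) s₀ (min t s₀) (op A y₀) +
    ∑ b ∈ F, psi S (op A) b (min t b) (B.mulVec (u b)) with hy
  refine ⟨v, y, ⟨⟨fun s _ => ?_, fun s _ => ?_⟩, ?_⟩, ⟨?_, ?_, ?_⟩, ?_⟩
  · exact ⟨_, tendsto_finsetSum F fun b _ => tendsto_step_right S b s (u b)⟩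
  · exact ⟨_, tendsto_finsetSum F fun b _ => tendsto_step_left S b s (u b)⟩
  · refine F.finite_toSet.subset fun s hs => ?_
    by_contra hsF
    refine hs.2 (tendsto_finsetSum F fun b hb => continuousWithinAt_step S (u b) ?_)
    rintro rfl
    exact hsF hb
  · have : ∀ b ∈ F, psi S (op A) b (min s₀ b) (B.mulVec (u b)) = 0 := fun b hb => by
      rw [min_eq_right (hsub (hF b hb)).2]
      simp
    simp [hy, Finset.sum_eq_zero this]
  · refine (continuousOn_const.add (continuousOn_psi_min _ _ hS hsub hs₀)).add
      (continuousOn_finsetSum F fun b hb => continuousOn_psi_min _ _ hS hsub (hF b hb))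
  · intro s hs hlt hcont
    have hex : ∃ τ ∈ S, τ < s := ⟨s₁, hs₁, hlt⟩
    have hterm : ∀ b ∈ F, HasNablaDerivAt S (fun t => psi S (op A) b (min t b) (B.mulVec (u b)))
        (op A (psi S (op A) b (min s b) (B.mulVec (u b))) +
          if s ≤ b then B.mulVec (u b) else 0) s := by
      intro b hb
      refine hasNablaDerivAt_psi_min _ _ hS hsub (hF b hb) hs hex fun hld hsb hcl => ?_
      -- The other steps jump elsewhere, so continuity of `v` at `b` passes to the single step `w
      -- b`; at a limit point from the right this forces `u b = 0`.
      have hc : ContinuousWithinAt (w b) S s := by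
        have e : w b = fun t => v t - ∑ b' ∈ F.erase b, w b' t := by
          funext t
          rw [hv, eq_sub_iff_add_eq]
          exact Finset.add_sum_erase F (fun b' => w b' t) hb
        rw [e]
        refine (hcont hld).sub (tendsto_finsetSum _ fun b' hb' => ?_)
        refine continuousWithinAt_step S (u b') ?_
        rw [hsb]
        exact (Finset.ne_of_mem_erase hb').symm
      rw [hsb] at hc
      rw [eq_zero_of_continuousWithinAt_step hc hcl, Matrix.mulVec_zero]
    have hhom := hasNablaDerivAt_psi_min (op A) (op A y₀) hS hsub hs₀ hs hex
      fun _ _ hcl => by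
        have : S ∩ Ioi s₀ = ∅ := by
          ext r
          simp only [mem_inter_iff, mem_Ioi, mem_empty_iff_false, iff_false, not_and, not_lt]
          exact fun hr => (hsub hr).2
        simp [this] at hcl
    have := ((hasNablaDerivAt_const y₀).add hhom).add (HasNablaDerivAt.sum hterm)
    convert this using 1
    rw [if_pos (hsub hs).2]
    have e1 : ∀ z, A.mulVec z = op A z := fun z => rfl
    have e2 : B.mulVec (v s) = ∑ b ∈ F, if s ≤ b then B.mulVec (u b) else 0 := by
      simp only [hv, hw]
      rw [← Matrix.mulVecLin_apply, map_sum]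
      refine Finset.sum_congr rfl fun b _ => ?_
      split_ifs <;> simp
    rw [e1, e2, Finset.sum_add_distrib]
    simp only [hy, map_add, map_sum]
    abel
  · simp only [hy]
    rw [min_eq_left hs₀.1.1]
    congr 1
    refine Finset.sum_congr rfl fun b hb => ?_
    rw [min_eq_left (hsub (hF b hb)).1]

/-! ### The span of the step responses. -/

lemma psi_mul_comm {𝔸 : Type*} [NormedRing 𝔸] [NormedAlgebra ℝ 𝔸] [NormOneClass 𝔸]
    [CompleteSpace 𝔸] {S : Set ℝ} (hS : IsClosed S) {b t : ℝ} (hb : b ∈ S) (ht : t ≤ b) (X : 𝔸) :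
    psi S X b t * X = X * psi S X b t := by
  rw [psi, ← (summable_psi X hS hb ht).tsum_mul_left, ← (summable_psi X hS hb ht).tsum_mul_right]
  exact tsum_congr fun k => by rw [smul_mul_assoc, mul_smul_comm, pow_mul_comm']

section

variable {n m : ℕ} {S : Set ℝ} {s₁ s₀ : ℝ}
  (X : (Fin n → ℝ) →L[ℝ] (Fin n → ℝ)) (B : Matrix (Fin n) (Fin m) ℝ)

/-- The space of the states reached at `s₁` from `0` by step controls with steps up to `b`. -/
noncomputable def stepSpace (S : Set ℝ) (X : (Fin n → ℝ) →L[ℝ] (Fin n → ℝ))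
    (B : Matrix (Fin n) (Fin m) ℝ) (s₁ b : ℝ) : Submodule ℝ (Fin n → ℝ) :=
  Submodule.span ℝ {x | ∃ c ∈ S, c ≤ b ∧ ∃ u, psi S X c s₁ (B.mulVec u) = x}

variable {B}

lemma psi_mem_stepSpace {b c : ℝ} (hc : c ∈ S) (hcb : c ≤ b) (u : Fin m → ℝ) :
    psi S X c s₁ (B.mulVec u) ∈ stepSpace S X B s₁ b :=
  Submodule.subset_span ⟨c, hc, hcb, u, rfl⟩

lemma exists_mem_sum_of_mem_stepSpace {b : ℝ} {x : Fin n → ℝ} (hx : x ∈ stepSpace S X B s₁ b) :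
    ∃ (F : Finset ℝ) (u : ℝ → Fin m → ℝ), (∀ c ∈ F, c ∈ S) ∧
      ∑ c ∈ F, psi S X c s₁ (B.mulVec (u c)) = x := by
  classical
  induction hx using Submodule.span_induction with
  | mem x hx =>
    obtain ⟨c, hc, -, u, rfl⟩ := hx
    exact ⟨{c}, fun _ => u, by simpa using hc, by simp⟩
  | zero => exact ⟨∅, 0, by simp, by simp⟩
  | add x y _ _ hx hy =>
    obtain ⟨F, u, hF, rfl⟩ := hx
    obtain ⟨G, v, hG, rfl⟩ := hy
    refine ⟨F ∪ G, fun c => (if c ∈ F then u c else 0) + (if c ∈ G then v c else 0),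
      fun c hc => (Finset.mem_union.1 hc).elim (hF c) (hG c), ?_⟩
    simp only [Matrix.mulVec_add, map_add, Finset.sum_add_distrib]
    congr 1
    · rw [← Finset.sum_subset Finset.subset_union_left fun c _ hc => by simp [hc]]
      exact Finset.sum_congr rfl fun c hc => by rw [if_pos hc]
    · rw [← Finset.sum_subset Finset.subset_union_right fun c _ hc => by simp [hc]]
      exact Finset.sum_congr rfl fun c hc => by rw [if_pos hc]
  | smul r x _ hx =>
    obtain ⟨F, u, hF, rfl⟩ := hx
    refine ⟨F, fun c => r • u c, hF, ?_⟩
    simp only [Matrix.mulVec_smul, map_smul, Finset.smul_sum]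

variable [NeZero n]

/-- `psi S X c a / (c - a)` is close to `-1` for a suitable `c > a`. -/
lemma exists_psi_approx (hS : IsClosed S) (hsub : S ⊆ Icc s₁ s₀) {a b : ℝ} (ha : a ∈ S)
    (hb : b ∈ S) (hab : a < b) (x : Fin n → ℝ) {η : ℝ} (hη : 0 < η) :
    ∃ c ∈ S, a < c ∧ c ≤ b ∧ ‖psi S X c a x + (c - a) • x‖ ≤ η * (c - a) := by
  -- If `a` is a limit from the right, take `c` so close that the quadratic error is absorbed by
  -- `η`; otherwise the next point `c` gives error zero.
  by_cases hcl : a ∈ closure (S ∩ Ioi a)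
  · set K := psiConst X (s₀ - s₁) * ‖x‖ with hK
    have hK0 : 0 ≤ K := mul_nonneg
      (psiConst_nonneg X (sub_nonneg.2 ((hsub ha).1.trans (hsub ha).2))) (norm_nonneg _)
    obtain ⟨c, ⟨hcS, hac⟩, hd⟩ := Metric.mem_closure_iff.1 hcl (min (b - a) (η / (K + 1)))
      (lt_min (sub_pos.2 hab) (by positivity))
    have hac : a < c := hac
    rw [dist_comm, Real.dist_eq, abs_of_pos (sub_pos.2 hac)] at hd
    have hd1 := hd.trans_le (min_le_left _ _)
    have hd2 := hd.trans_le (min_le_right _ _)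
    refine ⟨c, hcS, hac, by linarith, ?_⟩
    have h1 := norm_psi_error_le X hS hcS (L := s₀ - s₁) (a := s₁)
      (by linarith [(hsub hcS).2]) ⟨(hsub ha).1, hac.le⟩ ⟨(hsub hcS).1, le_rfl⟩ ha hcS
    have h2 := ContinuousLinearMap.le_opNorm
      (psi S X c c - psi S X c a - (c - a) • (1 + X * psi S X c c)) x
    rw [psi_self, mul_zero, add_zero, zero_sub] at h1 h2
    have e : (-psi S X c a - (c - a) • (1 : (Fin n → ℝ) →L[ℝ] (Fin n → ℝ))) x =
        -(psi S X c a x + (c - a) • x) := by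
      simp only [sub_apply, neg_apply, smul_apply, one_apply_eq_self]
      abel
    rw [e, norm_neg] at h2
    rw [lt_div_iff₀ (by positivity)] at hd2
    have h3 := mul_le_mul_of_nonneg_right h1 (norm_nonneg x)
    have hca := sub_pos.2 hac
    calc _ ≤ K * (c - a) ^ 2 := by rw [hK, mul_right_comm]; exact h2.trans h3
      _ = (c - a) * K * (c - a) := by ring
      _ ≤ _ := by
        gcongr
        linarith
  · set c := sInf (S ∩ Ioi a) with hc
    have hbdd : BddBelow (S ∩ Ioi a) := ⟨a, fun x hx => le_of_lt hx.2⟩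
    have hmem : c ∈ closure (S ∩ Ioi a) := csInf_mem_closure ⟨b, hb, hab⟩ hbdd
    have hcS : c ∈ S := closure_minimal inter_subset_left hS hmem
    have hac : a < c := by
      refine lt_of_le_of_ne (le_csInf ⟨b, hb, hab⟩ fun x hx => le_of_lt hx.2) ?_
      intro h
      exact hcl (h ▸ hmem)
    refine ⟨c, hcS, hac, csInf_le hbdd ⟨hb, hab⟩, ?_⟩
    have := psi_sub_of_gap X hS hcS hac.le le_rfl hcS fun r hr har => csInf_le hbdd ⟨hr, har⟩
    rw [psi_self, mul_zero, add_zero, zero_sub, neg_eq_iff_eq_neg] at this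
    rw [this]
    simp only [neg_apply, smul_apply, one_apply_eq_self, neg_add_cancel, norm_zero]
    exact mul_nonneg hη.le (sub_pos.2 hac).le

/-- By the cocycle identity the difference of the steps at `a` and `c` is `-Φ (psi S X c a x)`, and
`psi S X c a x` is nearly `-(c - a) • x`. The quotients approximate `Φ x`, and a finite-dimensional
subspace is closed. -/
lemma transition_mem_stepSpace (hS : IsClosed S) (hsub : S ⊆ Icc s₁ s₀) (hs₁ : s₁ ∈ S) {a b : ℝ}
    (ha : a ∈ S) (hb : b ∈ S) (hab : a < b) (u : Fin m → ℝ) :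
    B.mulVec u + X (psi S X a s₁ (B.mulVec u)) ∈ stepSpace S X B s₁ b := by
  set W := stepSpace S X B s₁ b with hW
  set x := B.mulVec u with hx
  set Φ : (Fin n → ℝ) →L[ℝ] (Fin n → ℝ) := 1 + psi S X a s₁ * X with hΦ
  have hcomm : B.mulVec u + X (psi S X a s₁ (B.mulVec u)) = Φ x := by
    rw [hΦ, psi_mul_comm hS ha (hsub ha).1]
    rfl
  rw [hcomm, ← SetLike.mem_coe, ← W.closed_of_finiteDimensional.closure_eq, Metric.mem_closure_iff]
  intro ε hε
  obtain ⟨c, hcS, hac, hcb, hle⟩ := exists_psi_approx X hS hsub ha hb hab x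
    (η := ε / (‖Φ‖ + 1)) (by positivity)
  have hca := sub_pos.2 hac
  refine ⟨(c - a)⁻¹ • (psi S X a s₁ x - psi S X c s₁ x),
    W.smul_mem _ (W.sub_mem (psi_mem_stepSpace X ha hab.le u) (psi_mem_stepSpace X hcS hcb u)), ?_⟩
  have h1 := psi_apply_eq X x hS hsub ha hcS hac hs₁ (hsub ha).1
  have h2 : psi S X a s₁ x - psi S X c s₁ x = -Φ (psi S X c a x) := by
    rw [h1, hΦ]
    simp only [add_apply, one_apply_eq_self, mul_apply_eq_comp, map_add]
    abel
  have h3 : Φ x - (c - a)⁻¹ • (psi S X a s₁ x - psi S X c s₁ x) =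
      (c - a)⁻¹ • Φ (psi S X c a x + (c - a) • x) := by
    rw [h2, map_add, map_smul, smul_add, smul_smul, inv_mul_cancel₀ hca.ne', one_smul, smul_neg]
    abel
  rw [dist_eq_norm, h3, norm_smul, norm_inv, Real.norm_eq_abs, abs_of_pos hca,
    inv_mul_lt_iff₀ hca]
  calc _ ≤ ‖Φ‖ * (ε / (‖Φ‖ + 1) * (c - a)) := (Φ.le_opNorm _).trans (by gcongr)
    _ = ‖Φ‖ / (‖Φ‖ + 1) * ((c - a) * ε) := by ring
    _ < 1 * ((c - a) * ε) := by
      gcongr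
      rw [div_lt_one (by positivity)]
      linarith
    _ = _ := one_mul _

lemma mulVec_mem_stepSpace (hS : IsClosed S) (hsub : S ⊆ Icc s₁ s₀) (hs₁ : s₁ ∈ S) {b : ℝ}
    (hb : b ∈ S) (hab : s₁ < b) (u : Fin m → ℝ) : B.mulVec u ∈ stepSpace S X B s₁ b := by
  simpa using transition_mem_stepSpace X hS hsub hs₁ hs₁ hb hab u

/-- On a generator, `X` gives the vector of `transition_mem_stepSpace` minus `B u`. -/
lemma apply_mem_stepSpace (hS : IsClosed S) (hsub : S ⊆ Icc s₁ s₀) (hs₁ : s₁ ∈ S) {a b : ℝ}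
    (ha : a ∈ S) (hb : b ∈ S) (hab : a < b) {x : Fin n → ℝ} (hx : x ∈ stepSpace S X B s₁ a) :
    X x ∈ stepSpace S X B s₁ b := by
  refine (Submodule.span_le (p := (stepSpace S X B s₁ b).comap X.toLinearMap)).2 ?_ hx
  rintro _ ⟨c, hc, hca, u, rfl⟩
  have h1 := transition_mem_stepSpace (B := B) X hS hsub hs₁ hc hb (hca.trans_lt hab) u
  have h2 := mulVec_mem_stepSpace (B := B) X hS hsub hs₁ hb ((hsub ha).1.trans_lt hab) u
  simpa using (stepSpace S X B s₁ b).sub_mem h1 h2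

/-- If `S` has at least `k + 1` points up to `b`, step controls reach `X ^ j B u` for `j < k`. -/
lemma pow_apply_mem_stepSpace (hS : IsClosed S) (hsub : S ⊆ Icc s₁ s₀) (hs₁ : s₁ ∈ S) (k : ℕ) :
    ∀ b ∈ S, ((k + 1 : ℕ) : ℕ∞) ≤ (S ∩ Iic b).encard → ∀ j < k, ∀ u : Fin m → ℝ,
      (X ^ j) (B.mulVec u) ∈ stepSpace S X B s₁ b := by
  induction k with
  | zero => exact fun b _ _ j hj => absurd hj (Nat.not_lt_zero j)
  | succ k ih =>
    intro b hb hcard j hj u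
    have h1 : ((k + 1 : ℕ) : ℕ∞) ≤ (S ∩ Iio b).encard := by
      have e : S ∩ Iic b = insert b (S ∩ Iio b) := by
        ext x
        simp only [mem_inter_iff, mem_Iic, mem_insert_iff, mem_Iio]
        constructor
        · rintro ⟨h, h'⟩
          exact h'.eq_or_lt.imp id fun h'' => ⟨h, h''⟩
        · rintro (rfl | ⟨h, h'⟩)
          · exact ⟨hb, le_rfl⟩
          · exact ⟨h, h'.le⟩
      rw [e, encard_insert_of_notMem (by simp)] at hcard
      exact (ENat.add_le_add_iff_right ENat.one_ne_top).1 (by exact_mod_cast hcard)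
    -- `b` may have no predecessor in `S`; the largest of `k + 1` chosen points below `b` takes its
    -- place.
    obtain ⟨F, hF, hFcard⟩ := exists_subset_encard_eq h1
    have hfin : F.Finite := finite_of_encard_eq_coe hFcard
    have hne : F.Nonempty := by
      rw [← encard_ne_zero, hFcard]
      exact_mod_cast k.succ_ne_zero
    obtain ⟨a, haF, hmax⟩ := hfin.exists_maximalFor id F hne
    have haS := (hF haF).1
    have hab : a < b := (hF haF).2
    have hFa : F ⊆ S ∩ Iic a := fun x hx => ⟨(hF hx).1, by
      by_contra hlt
      exact hlt (hmax hx (le_of_lt (not_le.1 hlt)))⟩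
    cases j with
    | zero => simpa using mulVec_mem_stepSpace X hS hsub hs₁ hb ((hsub haS).1.trans_lt hab) u
    | succ j =>
      rw [pow_succ']
      exact apply_mem_stepSpace X hS hsub hs₁ haS hb hab
        (ih a haS (hFcard.symm.le.trans (encard_le_encard hFa)) j (by omega) u)

end

/-! ### Rank conditions as statements about annihilators. -/

lemma rank_blockRow_eq_iff {K : Type*} [Field K] {n m : ℕ} (M : ℕ → Matrix (Fin n) (Fin m) K) :
    (blockRow M).rank = n ↔ ∀ w : Fin n → K, (∀ k < n, Matrix.vecMul w (M k) = 0) → w = 0 := by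
  have h1 : (blockRow M).rank = n ↔ LinearIndependent K (blockRow M).row := by
    rw [linearIndependent_iff_card_eq_finrank_span, Fintype.card_fin, Set.finrank,
      ← Matrix.rank_eq_finrank_span_row, eq_comm]
  have h2 : ∀ w : Fin n → K, Matrix.vecMul w (blockRow M) = 0 ↔
      ∀ k < n, Matrix.vecMul w (M k) = 0 := by
    intro w
    constructor
    · intro h k hk
      funext j
      exact congrFun h (⟨k, hk⟩, j)
    · intro h
      funext ⟨k, j⟩
      exact congrFun (h k k.2) j
  rw [h1, ← Matrix.vecMul_injective_iff]
  simp only [← h2]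
  exact injective_iff_map_eq_zero' (Matrix.vecMulLinear (blockRow M)) |>.trans
    ⟨fun h w => (h w).1, fun h w => ⟨h w, fun hw => by simp [hw]⟩⟩

lemma P_sub_pow_mem_span {n : ℕ} (A : Matrix (Fin n) (Fin n) ℝ) (lam : ℕ → ℂ) (k : ℕ) :
    P A lam k - (A.map Complex.ofReal) ^ k ∈
      Submodule.span ℂ ((fun i => (A.map Complex.ofReal) ^ i) '' Iio k) := by
  set C := A.map Complex.ofReal with hC
  induction k with
  | zero => simp [P]
  | succ k ih =>
    have e : P A lam (k + 1) - C ^ (k + 1) =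
        C * (P A lam k - C ^ k) - lam (k + 1) • (P A lam k - C ^ k) - lam (k + 1) • C ^ k := by
      simp only [P, ← hC, sub_mul, mul_sub, smul_mul_assoc, one_mul, smul_sub, pow_succ']
      abel
    have hmono : Submodule.span ℂ ((fun i => C ^ i) '' Iio k) ≤
        Submodule.span ℂ ((fun i => C ^ i) '' Iio (k + 1)) :=
      Submodule.span_mono (image_mono (Iio_subset_Iio k.le_succ))
    rw [e]
    refine Submodule.sub_mem _ (Submodule.sub_mem _ ?_ (Submodule.smul_mem _ _ (hmono ih)))
      (Submodule.smul_mem _ _ (Submodule.subset_span ⟨k, k.lt_succ_self, rfl⟩))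
    refine (Submodule.span_le (p := (Submodule.span ℂ ((fun i => C ^ i) '' Iio (k + 1))).comap
      (LinearMap.mulLeft ℂ C))).2 ?_ ih
    rintro _ ⟨i, hi, rfl⟩
    exact Submodule.subset_span ⟨i + 1, Nat.succ_lt_succ hi, pow_succ' C i⟩

/-- The linear map `X ↦ w X B`. -/
def vecMulMulLinear {R : Type*} [CommRing R] {n m : ℕ} (w : Fin n → R)
    (B : Matrix (Fin n) (Fin m) R) : Matrix (Fin n) (Fin n) R →ₗ[R] (Fin m → R) where
  toFun X := Matrix.vecMul w (X * B)
  map_add' X Y := by rw [Matrix.add_mul, Matrix.vecMul_add]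
  map_smul' c X := by rw [Matrix.smul_mul, Matrix.vecMul_smul]; rfl

/-- The change between the two families is unitriangular: once `w` annihilates the lower powers, `P
A lam k` and the `k`-th power act alike. -/
lemma forall_vecMul_P_eq_zero_iff {n m : ℕ} (A : Matrix (Fin n) (Fin n) ℝ) (lam : ℕ → ℂ)
    (B : Matrix (Fin n) (Fin m) ℂ) (w : Fin n → ℂ) (K : ℕ) :
    (∀ k < K, Matrix.vecMul w (P A lam k * B) = 0) ↔
      ∀ k < K, Matrix.vecMul w ((A.map Complex.ofReal) ^ k * B) = 0 := by
  set C := A.map Complex.ofReal with hC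
  set f := vecMulMulLinear w B
  have key : ∀ k, (∀ i < k, f (C ^ i) = 0) → f (P A lam k) = f (C ^ k) := by
    intro k hk
    rw [← sub_eq_zero, ← map_sub]
    refine (Submodule.span_le (p := LinearMap.ker f)).2 ?_ (P_sub_pow_mem_span A lam k)
    rintro _ ⟨i, hi, rfl⟩
    exact hk i hi
  change (∀ k < K, f (P A lam k) = 0) ↔ ∀ k < K, f (C ^ k) = 0
  constructor
  · intro h k
    induction k using Nat.strong_induction_on with
    | _ k ih =>
      intro hk
      rw [← key k fun i hi => ih i hi (hi.trans hk)]
      exact h k hk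
  · intro h k hk
    rw [key k fun i hi => h i (hi.trans hk)]
    exact h k hk

lemma vecMul_map_ofReal_eq_zero_iff {n m : ℕ} (N : Matrix (Fin n) (Fin m) ℝ) (w : Fin n → ℂ) :
    Matrix.vecMul w (N.map Complex.ofReal) = 0 ↔
      Matrix.vecMul (fun i => (w i).re) N = 0 ∧ Matrix.vecMul (fun i => (w i).im) N = 0 := by
  simp only [funext_iff, ← forall_and, Matrix.vecMul, dotProduct, Complex.ext_iff,
    Matrix.map_apply, Pi.zero_apply, Complex.re_sum, Complex.im_sum, Complex.mul_re,
    Complex.mul_im, Complex.ofReal_re, Complex.ofReal_im, mul_zero, sub_zero, zero_add,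
    Complex.zero_re, Complex.zero_im]

lemma rank_blockRow_P_eq_iff {n m : ℕ} (A : Matrix (Fin n) (Fin n) ℝ)
    (B : Matrix (Fin n) (Fin m) ℝ) (lam : ℕ → ℂ) :
    (blockRow fun k => P A lam k * B.map Complex.ofReal).rank = n ↔
      (blockRow fun k => A ^ k * B).rank = n := by
  have hmap : ∀ k, (A.map Complex.ofReal) ^ k * B.map Complex.ofReal =
      (A ^ k * B).map Complex.ofReal := by
    intro k
    have h1 : (A ^ k).map Complex.ofReal = (A.map Complex.ofReal) ^ k :=
      map_pow (Complex.ofRealHom.mapMatrix (m := Fin n)) A k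
    have h2 : (A ^ k * B).map Complex.ofReal =
        (A ^ k).map Complex.ofReal * B.map Complex.ofReal :=
      Matrix.map_mul (f := Complex.ofRealHom)
    rw [h2, h1]
  rw [rank_blockRow_eq_iff, rank_blockRow_eq_iff]
  simp only [forall_vecMul_P_eq_zero_iff, hmap, vecMul_map_ofReal_eq_zero_iff]
  constructor
  · intro h w hw
    have := h (fun i => (w i : ℂ)) fun k hk => ⟨by simpa using hw k hk, by
      simp only [Complex.ofReal_im]; exact Matrix.zero_vecMul _⟩
    funext i
    exact Complex.ofReal_eq_zero.1 (congrFun this i)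
  · intro h w hw
    have h1 := h _ fun k hk => (hw k hk).1
    have h2 := h _ fun k hk => (hw k hk).2
    funext i
    exact Complex.ext (congrFun h1 i) (congrFun h2 i)

/-- A proper `W` lies in the kernel of a nonzero functional, whose coordinate vector would
annihilate every block. -/
lemma eq_top_of_forall_mulVec_mem {n m : ℕ} {M : ℕ → Matrix (Fin n) (Fin m) ℝ}
    (hM : (blockRow M).rank = n) (W : Submodule ℝ (Fin n → ℝ))
    (h : ∀ k < n, ∀ u, (M k).mulVec u ∈ W) : W = ⊤ := by
  by_contra hne
  obtain ⟨f, hf, hle⟩ := W.exists_le_ker_of_lt_top (lt_top_iff_ne_top.2 hne)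
  set w : Fin n → ℝ := fun i => f (Pi.single i 1) with hw
  have hfw : ∀ x, f x = w ⬝ᵥ x := by
    intro x
    rw [LinearMap.pi_apply_eq_sum_univ f x]
    simp only [dotProduct, smul_eq_mul, hw]
    refine Finset.sum_congr rfl fun i _ => ?_
    rw [mul_comm]
    congr 2
    funext j
    simp [Pi.single_apply, eq_comm]
  have hw0 : w = 0 := (rank_blockRow_eq_iff M).1 hM w fun k hk => by
    refine dotProduct_eq_zero _ fun u => ?_
    rw [← Matrix.dotProduct_mulVec, ← hfw]
    exact hle (h k hk u)
  exact hf (LinearMap.ext fun x => by simp [hfw, hw0])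

lemma vecMul_pow_mul_eq_zero {n m : ℕ} (hn : n ≠ 0) (A : Matrix (Fin n) (Fin n) ℝ)
    (B : Matrix (Fin n) (Fin m) ℝ) (w : Fin n → ℝ)
    (h : ∀ k < n, Matrix.vecMul w (A ^ k * B) = 0) (k : ℕ) : Matrix.vecMul w (A ^ k * B) = 0 := by
  have hdeg : (Polynomial.X ^ k %ₘ A.charpoly).natDegree < n := by
    have h1 := Matrix.charpoly_natDegree_eq_dim A
    rw [Fintype.card_fin] at h1
    refine (Polynomial.natDegree_modByMonic_lt _ (Matrix.charpoly_monic A) ?_).trans_eq h1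
    intro h2
    rw [h2, Polynomial.natDegree_one] at h1
    exact hn h1.symm
  change vecMulMulLinear w B (A ^ k) = 0
  rw [Matrix.pow_eq_aeval_mod_charpoly, Polynomial.aeval_eq_sum_range' hdeg, map_sum]
  refine Finset.sum_eq_zero fun i hi => ?_
  rw [map_smul]
  exact (congrArg _ (h i (Finset.mem_range.1 hi))).trans (smul_zero _)

/-! ### Necessity, sufficiency and the equivalence. -/

/-- The difference of two states reachable from the same state lies in every invariant subspace
that contains the range of `B`. -/
lemma sub_mem_of_mem_reachableSet {n m : ℕ} {T : Set ℝ} (hT : IsClosed T)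
    {A : Matrix (Fin n) (Fin n) ℝ} {B : Matrix (Fin n) (Fin m) ℝ} {y₀ : Fin n → ℝ} {s₁ s₀ : ℝ}
    (hs₁ : s₁ ∈ interval T s₁ s₀) (hs₀ : s₀ ∈ interval T s₁ s₀) (V : Submodule ℝ (Fin n → ℝ))
    (hA : ∀ x ∈ V, A.mulVec x ∈ V) (hB : ∀ u, B.mulVec u ∈ V) {x x' : Fin n → ℝ}
    (hx : x ∈ reachableSet T A B y₀ s₁ s₀) (hx' : x' ∈ reachableSet T A B y₀ s₁ s₀) :
    x - x' ∈ V := by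
  obtain ⟨v, y, hv, ⟨hy0, hyc, hyd⟩, rfl⟩ := hx
  obtain ⟨v', y', hv', ⟨hy0', hyc', hyd'⟩, rfl⟩ := hx'
  set S := interval T s₁ s₀ with hS
  have hsub : S ⊆ Icc s₁ s₀ := inter_subset_left
  obtain ⟨C, hVC⟩ := V.exists_isCompl
  -- A projection with kernel `V`: it kills `B u`, and `π A x` depends only on `π x`, so `π (y -
  -- y')` solves a homogeneous equation.
  set π : (Fin n → ℝ) →L[ℝ] (Fin n → ℝ) :=
    LinearMap.toContinuousLinearMap (C.projection V hVC.symm) with hπ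
  have hker : ∀ x, π x = 0 ↔ x ∈ V := fun x => C.projection_apply_eq_zero_iff hVC.symm
  have hidem : ∀ x, π (π x) = π x := fun x =>
    C.projection_apply_of_mem_left hVC.symm (C.projection_apply_mem hVC.symm x)
  have hπA : ∀ x, π (A.mulVec x) = π (A.mulVec (π x)) := by
    intro x
    rw [← sub_eq_zero, ← map_sub, ← Matrix.mulVec_sub, hker]
    refine hA _ ((hker _).1 ?_)
    rw [map_sub, hidem, sub_self]
  have := eq_zero_of_nablaDeriv_le (isClosed_interval hT s₁ s₀) hsub hs₀
    (z := fun t => π (y t - y' t)) (d := fun t => (π ∘L op A) (π (y t - y' t)))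
    (π.continuous.comp_continuousOn (hyc.sub hyc')) (by simp [hy0, hy0'])
    (hv.2.union hv'.2) (norm_nonneg (π ∘L op A)) ?_ (fun s _ => (π ∘L op A).le_opNorm _) s₁ hs₁
  · exact (hker _).1 this
  · rintro s hs ⟨τ, hτ, hlt⟩ hF
    have hlt := (hsub hτ).1.trans_lt hlt
    have h1 := hyd s hs hlt fun h => by
      by_contra hc
      exact hF h (Or.inl ⟨h, hc⟩)
    have h2 := hyd' s hs hlt fun h => by
      by_contra hc
      exact hF h (Or.inr ⟨h, hc⟩)
    convert (h1.sub h2).clm_comp π using 1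
    change π (A.mulVec (π (y s - y' s))) = _
    rw [← hπA, Matrix.mulVec_sub]
    simp only [map_sub, map_add, (hker _).2 (hB _)]
    abel

lemma zero_mem_reachableSet_zero {n m : ℕ} (T : Set ℝ) (A : Matrix (Fin n) (Fin n) ℝ)
    (B : Matrix (Fin n) (Fin m) ℝ) (s₁ s₀ : ℝ) : 0 ∈ reachableSet T A B 0 s₁ s₀ := by
  refine ⟨fun _ => 0, fun _ => 0, ⟨⟨fun _ _ => ⟨0, tendsto_const_nhds⟩, fun _ _ => ⟨0, tendsto_const_nhds⟩⟩, ?_⟩,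
    ⟨rfl, continuousOn_const, fun s _ _ _ => ?_⟩, rfl⟩
  · convert finite_empty
    ext s
    simp [continuousWithinAt_const]
  · simpa using hasNablaDerivAt_const (S := interval T s₁ s₀) (s := s) (0 : Fin n → ℝ)

/-- The rank condition holds if every vector is the difference of two states reachable from a
common initial state. -/
lemma rank_eq_of_forall_exists_reachable {n m : ℕ} (hn : n ≠ 0) {T : Set ℝ} (hT : IsClosed T)
    {A : Matrix (Fin n) (Fin n) ℝ} {B : Matrix (Fin n) (Fin m) ℝ}
    (h : ∀ x : Fin n → ℝ, ∃ y₀ s₁ s₀, s₁ ∈ interval T s₁ s₀ ∧ s₀ ∈ interval T s₁ s₀ ∧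
      ∃ y ∈ reachableSet T A B y₀ s₁ s₀, ∃ y' ∈ reachableSet T A B y₀ s₁ s₀, y - y' = x) :
    (blockRow fun k => A ^ k * B).rank = n := by
  refine (rank_blockRow_eq_iff _).2 fun w hw => ?_
  have hw' := vecMul_pow_mul_eq_zero hn A B w hw
  let V : Submodule ℝ (Fin n → ℝ) :=
    { carrier := {x | ∀ k, w ⬝ᵥ (A ^ k).mulVec x = 0}
      add_mem' := fun {x y} hx hy k => by rw [Matrix.mulVec_add, dotProduct_add, hx, hy, add_zero]
      zero_mem' := fun k => by simp
      smul_mem' := fun c x hx k => by rw [Matrix.mulVec_smul, dotProduct_smul, hx, smul_zero] }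
  -- The vector to be reached is `w` itself; membership in `V` at `k = 0` reads `w ⬝ᵥ w = 0`.
  obtain ⟨y₀, s₁, s₀, hs₁, hs₀, y, hy, y', hy', hyw⟩ := h w
  have hmem := sub_mem_of_mem_reachableSet hT hs₁ hs₀ V
    (fun x hx k => by
      rw [Matrix.mulVec_mulVec, ← pow_succ]
      exact hx (k + 1))
    (fun u k => by
      rw [Matrix.mulVec_mulVec, Matrix.dotProduct_mulVec, hw' k, zero_dotProduct]) hy hy'
  rw [hyw] at hmem
  have := hmem 0
  rw [pow_zero, Matrix.one_mulVec] at this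
  exact dotProduct_self_eq_zero.1 this

lemma reachableSet_eq_univ_of_rank_eq {n m : ℕ} [NeZero n] {T : Set ℝ} (hT : IsClosed T)
    {A : Matrix (Fin n) (Fin n) ℝ} {B : Matrix (Fin n) (Fin m) ℝ}
    (hrank : (blockRow fun k => A ^ k * B).rank = n) {s₁ s₀ : ℝ}
    (hs₁ : s₁ ∈ interval T s₁ s₀) (hs₀ : s₀ ∈ interval T s₁ s₀)
    (hcard : ((n + 1 : ℕ) : ℕ∞) ≤ (interval T s₁ s₀).encard) (y₀ : Fin n → ℝ) :
    reachableSet T A B y₀ s₁ s₀ = univ := by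
  refine eq_univ_of_forall fun x => ?_
  have htop := eq_top_of_forall_mulVec_mem hrank
    (stepSpace (interval T s₁ s₀) (op A) B s₁ s₀) fun k hk u => by
      have hS : interval T s₁ s₀ ∩ Iic s₀ = interval T s₁ s₀ :=
        inter_eq_left.2 fun x hx => hx.1.2
      have := pow_apply_mem_stepSpace (B := B) (op A) (isClosed_interval hT s₁ s₀)
        inter_subset_left hs₁ n s₀ hs₀ (by rwa [hS]) k hk u
      have hpow : ∀ (k : ℕ) (z : Fin n → ℝ), (op A ^ k) z = (A ^ k).mulVec z := by
        intro k
        induction k with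
        | zero => simp
        | succ k ih =>
          intro z
          rw [pow_succ, mul_apply_eq_comp, ih, pow_succ, ← Matrix.mulVec_mulVec]
          rfl
      rwa [hpow, Matrix.mulVec_mulVec] at this
  obtain ⟨F, u, hF, hsum⟩ := exists_mem_sum_of_mem_stepSpace (op A) (htop ▸ Submodule.mem_top :
    x - (y₀ + psi (interval T s₁ s₀) (op A) s₀ s₁ (op A y₀)) ∈
      stepSpace (interval T s₁ s₀) (op A) B s₁ s₀)
  have := mem_reachableSet_of_step hT A B y₀ hs₁ hs₀ F hF u
  rwa [hsum, add_sub_cancel] at this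

end NablaControl

/-- Here `lam 1, …, lam n` are the eigenvalues of `A`, listed in any order with their algebraic
multiplicities. -/
theorem theorem4p3 {n m : ℕ} (hn : 1 ≤ n) (T : Set ℝ) (hT : NablaControl.IsTimeScale T)
    (A : Matrix (Fin n) (Fin n) ℝ) (B : Matrix (Fin n) (Fin m) ℝ)
    (lam : ℕ → ℂ)
    (hlam : (Finset.Icc 1 n).val.map lam = (A.map Complex.ofReal).charpoly.roots)
    (y₀ : Fin n → ℝ) (s₁ s₀ : ℝ)
    (hs₁ : s₁ ∈ NablaControl.dual T) (hs₀ : s₀ ∈ NablaControl.dual T)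
    (hcard : ((n + 1 : ℕ) : ℕ∞) ≤ (NablaControl.interval (NablaControl.dual T) s₁ s₀).encard) :
    List.TFAE
      [NablaControl.reachableSet (NablaControl.dual T) A B y₀ s₁ s₀ = Set.univ,
       (NablaControl.blockRow fun k => NablaControl.P A lam k * B.map Complex.ofReal).rank = n,
       (NablaControl.blockRow fun k => A ^ k * B).rank = n,
       NablaControl.IsControllable (NablaControl.dual T) A B] := by
  have hn0 : n ≠ 0 := Nat.one_le_iff_ne_zero.1 hn
  have : NeZero n := ⟨hn0⟩
  have hD := NablaControl.isClosed_dual hT.2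
  have hlt : s₁ < s₀ := by
    have h2 : 1 < (NablaControl.interval (NablaControl.dual T) s₁ s₀).encard :=
      lt_of_lt_of_le (by exact_mod_cast Nat.lt_succ_of_le hn) hcard
    obtain ⟨x, y, hx, hy, hxy⟩ := one_lt_encard_iff.1 h2
    by_contra hle
    have hxs := hx.1
    have hys := hy.1
    exact hxy (by linarith [hxs.1, hxs.2, hys.1, hys.2, not_lt.1 hle])
  have hmem : ∀ {a b : ℝ}, a ∈ NablaControl.dual T → b ∈ NablaControl.dual T → a ≤ b →
      a ∈ NablaControl.interval (NablaControl.dual T) a b ∧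
        b ∈ NablaControl.interval (NablaControl.dual T) a b := fun ha hb hab =>
    ⟨⟨left_mem_Icc.2 hab, ha⟩, ⟨right_mem_Icc.2 hab, hb⟩⟩
  obtain ⟨h₁, h₀⟩ := hmem hs₁ hs₀ hlt.le
  tfae_have 2 ↔ 3 := NablaControl.rank_blockRow_P_eq_iff A B lam
  tfae_have 3 → 1 := fun h =>
    NablaControl.reachableSet_eq_univ_of_rank_eq hD h h₁ h₀ hcard y₀
  tfae_have 3 → 4 := fun h z₀ z₁ => ⟨s₀, hs₀, s₁, hs₁, hlt, by
    rw [NablaControl.reachableSet_eq_univ_of_rank_eq hD h h₁ h₀ hcard z₀]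
    exact mem_univ _⟩
  tfae_have 1 → 3 := fun h =>
    NablaControl.rank_eq_of_forall_exists_reachable hn0 hD fun x =>
      ⟨y₀, s₁, s₀, h₁, h₀, x, h ▸ mem_univ _, 0, h ▸ mem_univ _, sub_zero x⟩
  -- The time interval may vary with `x`, so each `x` is compared with the zero state, reached from
  -- `0` on the same interval by the zero control.
  tfae_have 4 → 3 := fun h =>
    NablaControl.rank_eq_of_forall_exists_reachable hn0 hD fun x => by
      obtain ⟨t₀, ht₀, t₁, ht₁, ht, hx⟩ := h 0 x
      obtain ⟨h₁, h₀⟩ := hmem ht₁ ht₀ ht.le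
      exact ⟨0, t₁, t₀, h₁, h₀, x, hx, 0,
        NablaControl.zero_mem_reachableSet_zero _ A B t₁ t₀, sub_zero x⟩
  tfae_finish
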